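/- In generalized poset sorting there is an undirected query graph $G=(V,E)$ on $n$ vertices, which is known, and an unknown poset $\mathcal P=(V,\prec)$. A query of an edge $(u,v)\in E$ returns whether $u\prec v$, $v\prec u$, or $u$ and $v$ are incomparable. It is promised that $u\prec v$ holds if and only if $v$ can be reached from $u$ by a directed path of at least one edge in the digraph with edge set $\{(x,y) : \{x,y\}\in E,\ x\prec y\}$. The task is to output $\mathcal P$. Algorithms are adaptive and randomized (probability distributions over decision trees), and their cost is the number of queries. The width of a poset is the largest size of an antichain in it. (Upper bound.) There is a randomized algorithm, which is given only a complete bipartite graph $G$ and access to the query oracle (in particular, neither $\mathcal P$ nor its width), such that for some constant $d$ and for every constant $c\in\mathbb N$ there is a constant $C>0$ with the following property. For all $n\ge 2$, all complete bipartite query graphs $G$ on $n$ vertices and all posets $\mathcal P$ that satisfy the promise with $G$, with $k$ denoting the width of $\mathcal P$, the algorithm outputs $\mathcal P$ after at most $C\,nk\,(\log(nk))^d$ queries with probability at least $1-n^{-c}$. That is, $\tilde O(nk)$ queries suffice with high probability. (Tightness up to polylogarithmic factors.) There is a constant $c>0$ such that for all integers $1\le k<n$ there is a complete bipartite graph $G$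 on $n$ vertices with the following property. If a randomized algorithm with query graph $G$ (which may depend on $G$ and $k$) and a number $q$ are such that, for every poset $\mathcal P$ of width $k$ that satisfies the promise with $G$, the algorithm outputs $\mathcal P$ after at most $q$ queries with probability at least $2/3$, then $q\ge c\,nk$. -/

import Mathlib

/-! Generalized poset sorting: the query model and its cost measure. -/

namespace GPS

/-- The possible answers to a query `(u, v)`: `u ≺ v`, `v ≺ u`, or `u` and `v` incomparable. -/
inductive Answer : Type
  | less
  | greater
  | incomparable

open Classical in
/-- The relation of the distinct elements `u` and `v` in the poset `P`. -/
noncomputable def answer {V : Type} (P : PartialOrder V) (u v : V) : Answer :=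
  if P.lt u v then Answer.less else if P.lt v u then Answer.greater else Answer.incomparable

open Classical in
/-- The width of a finite poset: the largest size of an antichain. -/
noncomputable def width {V : Type} [Fintype V] (P : PartialOrder V) : ℕ :=
  (Finset.univ.filter fun s : Finset V => IsAntichain P.le (s : Set V)).sup Finset.card

/-- `G` is complete bipartite, with parts `s` and its complement. -/
def IsCompleteBipartite {V : Type} (G : SimpleGraph V) : Prop :=
  ∃ s : Set V, ∀ u v : V, G.Adj u v ↔ (u ∈ s ∧ v ∉ s) ∨ (u ∉ s ∧ v ∈ s)

/-- `(G, P)` is an instance of generalized poset sorting: orient every edge of `G` between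
comparable elements from the smaller to the larger one; then `u ≺ v` in `P` if and only if there
is a directed path from `u` to `v`. -/
def IsInstance {V : Type} (G : SimpleGraph V) (P : PartialOrder V) : Prop :=
  ∀ u v : V, P.lt u v ↔ Relation.TransGen (fun x y => G.Adj x y ∧ P.lt x y) u v

/-- A deterministic (adaptive) query algorithm with query graph `G`: a decision tree whose inner
nodes query an edge of `G` and branch on the answer, and whose leaves output a poset. -/
inductive QueryTree {V : Type} (G : SimpleGraph V) : Type
  | output (R : PartialOrder V) : QueryTree G
  | query (e : G.Dart) (next : Answer → QueryTree G) : QueryTree G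

namespace QueryTree

/-- The output of the algorithm when the unknown poset is `P`. -/
noncomputable def result {V : Type} {G : SimpleGraph V} (P : PartialOrder V) :
    QueryTree G → PartialOrder V
  | output R => R
  | query e next => result P (next (answer P e.fst e.snd))

/-- The number of queries that the algorithm makes when the unknown poset is `P`. -/
noncomputable def cost {V : Type} {G : SimpleGraph V} (P : PartialOrder V) :
    QueryTree G → ℕ
  | output _ => 0
  | query e next => cost P (next (answer P e.fst e.snd)) + 1

end QueryTree

/-- A randomized query algorithm: a probability distribution over deterministic ones. -/
abbrev RandomizedAlgorithm {V : Type} (G : SimpleGraph V) : Type := PMF (QueryTree G)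

/-- The probability that the algorithm `A`, run on the unknown poset `P`, outputs exactly `P` and
makes at most `q` queries. -/
noncomputable def successProb {V : Type} {G : SimpleGraph V} (A : RandomizedAlgorithm G)
    (P : PartialOrder V) (q : ℝ) : ℝ :=
  (A.toOuterMeasure {t | t.result P = P ∧ (t.cost P : ℝ) ≤ q}).toReal

end GPS

/-! The poset is learnt by inserting the vertices one after the other, in a uniformly random order.
When `v` is inserted, the order between any two adjacent vertices of the set `K` of earlier vertices
is known. It certifies some comparabilities on the opposite side of `v`: those `x < y` for which some
`a ∈ K` has `x < a < y`. The algorithm covers that side of `K` by as few certified chains as possible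
and locates `v` in each of them by two binary searches, which takes `O(log n)` queries per chain
(`insertAll_spec`). The output is always correct; only the cost is random.

It remains to see that `O(k log n)` certified chains suffice. By Dilworth's theorem (`dilworth`), the
poset consists of `k` chains. In one such chain, consecutive elements `b` and `b'` of the same side
have an element of the other side between them, by the promise; choose one as the partner of `b`.
The partners of the elements on one side of a chain are distinct. If, in an interval of one side of a
chain, `L` elements have been inserted but none of the partners has, then exchanging any of the `L`
elements with their partners gives `2 ^ L` different orders, so this has probability at most
`2 ^ (-L)` (`card_unpaired_mul_le`). With `L` a multiple of `log n`, a union bound shows that with high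
probability this never happens, and then any two elements of `K` on the same side of a chain at
distance at least `L` are certified to be comparable. So one side of a chain falls apart into at most
`L` certified chains (`length_chainCover_le_mul`).

For the lower bound, consider `N` instances of width `k`, each of which differs from a common poset on
a set of edges of its own. Along the path of a decision tree that belongs to the common poset, each
query distinguishes at most one instance from it, so that with `q` queries at most `q + 1` instances
are identified (`card_correct_le`), and averaging over the instances extends this to randomized
algorithms. Families with `N` of order `n k` are: layers of size `k` with one incomparable pair between
consecutive layers; for `k` close to `n`, a chain together with an antichain to which one comparable
pair is added; for `k = 1`, a chain in which two elements at distance `2` are exchanged. -/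

namespace GPS

/-! ### Dilworth's theorem -/

/-- Dilworth's theorem for a finite subset `S` of a poset, with the `w` chains given as the classes
of a colouring: some antichain in `S` has as many elements as there are colours. -/
theorem dilworth {α : Type} [PartialOrder α] (S : Finset α) :
    ∃ (w : ℕ) (χ : α → ℕ), (∀ x ∈ S, χ x < w) ∧
      (∀ x ∈ S, ∀ y ∈ S, χ x = χ y → x ≤ y ∨ y ≤ x) ∧
      ∃ A ⊆ S, IsAntichain (· ≤ ·) (A : Set α) ∧ A.card = w := by
  classical
  induction S using Finset.strongInduction with
  | H S ih =>
  rcases S.eq_empty_or_nonempty with rfl | hne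
  · exact ⟨0, fun _ => 0, by simp, by simp, ∅, by simp, by simp, by simp⟩
  obtain ⟨a, ha⟩ := S.exists_maximal hne
  have haS : a ∈ S := ha.prop
  have hamax : ∀ z ∈ S, a ≤ z → z = a := fun z hz h => le_antisymm (ha.le_of_ge hz h) h
  obtain ⟨w, χ, hχ, hch, A, hAS, hA, hAw⟩ := ih _ (Finset.erase_ssubset haS)
  -- an antichain with `w` elements meets every chain
  have meet : ∀ T ⊆ S.erase a, IsAntichain (· ≤ ·) (T : Set α) → T.card = w →
      ∀ i < w, ∃ z ∈ T, χ z = i := by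
    intro T hT hTa hTw i hi
    have hinj : Set.InjOn χ T := by
      intro x hx y hy hxy
      rcases hch x (hT hx) y (hT hy) hxy with h | h
      · exact hTa.eq hx hy h
      · exact hTa.eq' hx hy h
    have : T.image χ = Finset.range w := by
      apply Finset.eq_of_subset_of_card_le
      · intro j hj
        obtain ⟨z, hz, rfl⟩ := Finset.mem_image.1 hj
        exact Finset.mem_range.2 (hχ z (hT hz))
      · rw [Finset.card_image_of_injOn hinj, hTw, Finset.card_range]
    have hi' : i ∈ T.image χ := this ▸ Finset.mem_range.2 hi
    obtain ⟨z, hz, hzi⟩ := Finset.mem_image.1 hi'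
    exact ⟨z, hz, hzi⟩
  -- the highest element of each chain that lies in an antichain with `w` elements
  have top : ∀ i : ℕ, ∃ x : α, i < w → χ x = i ∧
      (∃ T ⊆ S.erase a, IsAntichain (· ≤ ·) (T : Set α) ∧ T.card = w ∧ x ∈ T) ∧
      ∀ T ⊆ S.erase a, IsAntichain (· ≤ ·) (T : Set α) → T.card = w →
        ∀ y ∈ T, χ y = i → y ≤ x := by
    intro i
    by_cases hi : i < w
    swap
    · exact ⟨a, fun h => absurd h hi⟩
    let M := (S.erase a).filter fun x => χ x = i ∧
      ∃ T ⊆ S.erase a, IsAntichain (· ≤ ·) (T : Set α) ∧ T.card = w ∧ x ∈ T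
    have hM : M.Nonempty := by
      obtain ⟨z, hz, hzi⟩ := meet A hAS hA hAw i hi
      exact ⟨z, Finset.mem_filter.2 ⟨hAS hz, hzi, A, hAS, hA, hAw, hz⟩⟩
    obtain ⟨x, hx⟩ := M.exists_maximal hM
    have hxM := Finset.mem_filter.1 hx.prop
    refine ⟨x, fun _ => ⟨hxM.2.1, hxM.2.2, ?_⟩⟩
    intro T hT hTa hTw y hy hyi
    rcases hch y (hT hy) x hxM.1 (hyi.trans hxM.2.1.symm) with h | h
    · exact h
    · exact hx.le_of_ge (Finset.mem_filter.2 ⟨hT hy, hyi, T, hT, hTa, hTw, hy⟩) h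
  choose x hx using top
  have hxS : ∀ i < w, x i ∈ S.erase a := fun i hi => by
    obtain ⟨T, hT, -, -, hxT⟩ := (hx i hi).2.1
    exact hT hxT
  have hxanti : ∀ i < w, ∀ j < w, i ≠ j → ¬ x i ≤ x j := by
    intro i hi j hj hij hle
    obtain ⟨T, hT, hTa, hTw, hxT⟩ := (hx j hj).2.1
    obtain ⟨y, hy, hyi⟩ := meet T hT hTa hTw i hi
    have h1 : y ≤ x i := (hx i hi).2.2 T hT hTa hTw y hy hyi
    have h2 : y = x j := hTa.eq hy hxT (h1.trans hle)
    exact hij (by rw [← hyi, h2, (hx j hj).1])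
  by_cases hcomp : ∃ i < w, x i ≤ a
  · -- remove the chain of `a` and of the part of the `i`-th chain up to `x i`
    obtain ⟨i, hi, hia⟩ := hcomp
    let K := S.filter fun z => z = a ∨ (z ≠ a ∧ χ z = i ∧ z ≤ x i)
    have hKS : S \ K ⊂ S := Finset.sdiff_ssubset (Finset.filter_subset _ _)
      ⟨a, Finset.mem_filter.2 ⟨haS, Or.inl rfl⟩⟩
    obtain ⟨w', χ', hχ', hch', A', hAS', hA', hAw'⟩ := ih _ hKS
    have hA'sub : A' ⊆ S.erase a := by
      intro z hz
      have := Finset.mem_sdiff.1 (hAS' hz)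
      refine Finset.mem_erase.2 ⟨?_, this.1⟩
      rintro rfl
      exact this.2 (Finset.mem_filter.2 ⟨this.1, Or.inl rfl⟩)
    have hle : A'.card ≤ w := by
      have hinj : Set.InjOn χ A' := by
        intro x hx y hy hxy
        rcases hch x (hA'sub hx) y (hA'sub hy) hxy with h | h
        · exact hA'.eq hx hy h
        · exact hA'.eq' hx hy h
      rw [← Finset.card_image_of_injOn hinj, ← Finset.card_range w]
      apply Finset.card_le_card
      intro j hj
      obtain ⟨z, hz, rfl⟩ := Finset.mem_image.1 hj
      exact Finset.mem_range.2 (hχ z (hA'sub hz))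
    have hlt : w' < w := by
      refine lt_of_le_of_ne (hAw' ▸ hle) fun h => ?_
      obtain ⟨y, hy, hyi⟩ := meet A' hA'sub hA' (hAw'.trans h) i hi
      have hyx := (hx i hi).2.2 A' hA'sub hA' (hAw'.trans h) y hy hyi
      have h1 := Finset.mem_sdiff.1 (hAS' hy)
      exact h1.2 (Finset.mem_filter.2
        ⟨h1.1, Or.inr ⟨(Finset.mem_erase.1 (hA'sub hy)).1, hyi, hyx⟩⟩)
    have hKchain : ∀ y ∈ K, ∀ z ∈ K, y ≤ z ∨ z ≤ y := by
      intro y hy z hz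
      obtain ⟨hyS, hy⟩ := Finset.mem_filter.1 hy
      obtain ⟨hzS, hz⟩ := Finset.mem_filter.1 hz
      rcases hy with rfl | ⟨hya, hyi, hyx⟩
      · rcases hz with rfl | ⟨hza, hzi, hzx⟩
        · exact Or.inl le_rfl
        · exact Or.inr (hzx.trans hia)
      · rcases hz with rfl | ⟨hza, hzi, hzx⟩
        · exact Or.inl (hyx.trans hia)
        · exact hch y (Finset.mem_erase.2 ⟨hya, hyS⟩) z (Finset.mem_erase.2 ⟨hza, hzS⟩)
            (hyi.trans hzi.symm)
    refine ⟨w, fun z => if z ∈ K then w' else χ' z, ?_, ?_, A,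
      hAS.trans (Finset.erase_subset _ _), hA, hAw⟩
    · intro z hz
      dsimp only
      split_ifs with h
      · exact hlt
      · exact (hχ' z (Finset.mem_sdiff.2 ⟨hz, h⟩)).trans hlt
    · intro y hy z hz
      dsimp only
      split_ifs with h1 h2 h2
      · exact fun _ => hKchain y h1 z h2
      · intro h
        exact absurd (hχ' z (Finset.mem_sdiff.2 ⟨hz, h2⟩)) (by omega)
      · intro h
        exact absurd (hχ' y (Finset.mem_sdiff.2 ⟨hy, h1⟩)) (by omega)
      · exact hch' y (Finset.mem_sdiff.2 ⟨hy, h1⟩) z (Finset.mem_sdiff.2 ⟨hz, h2⟩)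
  · -- `a` extends the antichain of the elements `x i`, and is a chain of its own
    push Not at hcomp
    have haT : a ∉ (Finset.range w).image x := by
      intro h
      obtain ⟨i, hi, hia⟩ := Finset.mem_image.1 h
      exact hcomp i (Finset.mem_range.1 hi) hia.le
    have hxinj : Set.InjOn x (Finset.range w) := by
      intro i hi j hj hij
      by_contra hne
      exact hxanti i (by simpa using hi) j (by simpa using hj) hne hij.le
    refine ⟨w + 1, fun z => if z = a then w else χ z, ?_, ?_,
      insert a ((Finset.range w).image x), ?_, ?_, ?_⟩
    · intro z hz
      dsimp only
      split_ifs with h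
      · exact Nat.lt_succ_self w
      · exact (hχ z (Finset.mem_erase.2 ⟨h, hz⟩)).trans (Nat.lt_succ_self w)
    · intro y hy z hz
      dsimp only
      split_ifs with h1 h2 h2
      · exact fun _ => Or.inl (h1.trans h2.symm).le
      · intro h
        exact absurd (hχ z (Finset.mem_erase.2 ⟨h2, hz⟩)) (by omega)
      · intro h
        exact absurd (hχ y (Finset.mem_erase.2 ⟨h1, hy⟩)) (by omega)
      · exact hch y (Finset.mem_erase.2 ⟨h1, hy⟩) z (Finset.mem_erase.2 ⟨h2, hz⟩)
    · intro z hz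
      rcases Finset.mem_insert.1 hz with rfl | hz
      · exact haS
      · obtain ⟨i, hi, rfl⟩ := Finset.mem_image.1 hz
        exact Finset.mem_of_mem_erase (hxS i (Finset.mem_range.1 hi))
    · rw [Finset.coe_insert]
      refine IsAntichain.insert ?_ ?_ ?_
      · intro y hy z hz hne
        obtain ⟨i, hi, rfl⟩ := Finset.mem_image.1 hy
        obtain ⟨j, hj, rfl⟩ := Finset.mem_image.1 hz
        exact hxanti i (Finset.mem_range.1 hi) j (Finset.mem_range.1 hj) (fun h => hne (h ▸ rfl))
      · intro y hy _ h
        obtain ⟨i, hi, rfl⟩ := Finset.mem_image.1 hy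
        exact hcomp i (Finset.mem_range.1 hi) h
      · intro y hy hne h
        obtain ⟨i, hi, rfl⟩ := Finset.mem_image.1 hy
        exact hne (hamax _ (Finset.mem_of_mem_erase (hxS i (Finset.mem_range.1 hi))) h).symm
    · rw [Finset.card_insert_of_notMem haT, Finset.card_image_of_injOn hxinj, Finset.card_range]

/-- A poset of width `k` can be partitioned into `k` chains. -/
theorem exists_chain_coloring {V : Type} [Fintype V] (P : PartialOrder V) :
    ∃ χ : V → ℕ, (∀ x, χ x < width P) ∧
      ∀ x y, χ x = χ y → x ≠ y → P.lt x y ∨ P.lt y x := by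
  classical
  obtain ⟨w, χ, h1, h2, A, -, hA, rfl⟩ := dilworth (Finset.univ : Finset V)
  have hw : A.card ≤ width P :=
    Finset.le_sup (f := Finset.card) (Finset.mem_filter.2 ⟨Finset.mem_univ _, hA⟩)
  refine ⟨χ, fun x => (h1 x (Finset.mem_univ _)).trans_le hw, fun x y hxy hne => ?_⟩
  exact (h2 x (Finset.mem_univ _) y (Finset.mem_univ _) hxy).imp
    (fun h => lt_of_le_of_ne h hne) (fun h => lt_of_le_of_ne h hne.symm)

/-! ### The insertion algorithm -/

section

variable {V : Type} {G : SimpleGraph V}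

/-- The partial order with a given strict order. -/
@[reducible] def orderOfLt (r : V → V → Prop) (irrefl : ∀ x, ¬ r x x)
    (trans : ∀ x y z, r x y → r y z → r x z) : PartialOrder V :=
  haveI : IsStrictOrder V r := { irrefl := irrefl, trans := trans }
  partialOrderOfSO r

theorem answer_eq_less {P : PartialOrder V} {u v : V} :
    answer P u v = Answer.less ↔ P.lt u v := by
  unfold answer
  split_ifs <;> simp_all

theorem answer_eq_greater {P : PartialOrder V} {u v : V} :
    answer P u v = Answer.greater ↔ P.lt v u := by
  unfold answer
  split_ifs with h1 h2
  · simpa using fun h2 => lt_asymm h1 h2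
  · simpa using h2
  · simpa using h2

open Classical in
/-- Binary search, in continuation-passing style: pass to `k` the members `x` of `l` for which
`answer P v x` is `t`. It is correct if these form a final segment of `l` and `l.length < 2 ^ d`,
and makes at most `d` queries. -/
noncomputable def bisect (v : V) (t : Answer) :
    ℕ → List V → (List V → QueryTree G) → QueryTree G
  | 0, _, k => k []
  | d + 1, l, k =>
    match l.drop (l.length / 2) with
    | [] => k []
    | x :: r =>
      if h : G.Adj v x then
        .query ⟨(v, x), h⟩ fun a =>
          if a = t then bisect v t d (l.take (l.length / 2)) fun s => k (s ++ x :: r)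
          else bisect v t d r k
      else k []

theorem bisect_spec (P : PartialOrder V) (v : V) (t : Answer) (d : ℕ) (l : List V)
    (k : List V → QueryTree G) (hl : l.length < 2 ^ d) (hadj : ∀ x ∈ l, G.Adj v x)
    (hmono : l.Pairwise fun x y => answer P v x = t → answer P v y = t) :
    ∃ s : List V, (∀ x, x ∈ s ↔ x ∈ l ∧ answer P v x = t) ∧
      (bisect v t d l k).result P = (k s).result P ∧
      (bisect v t d l k).cost P ≤ (k s).cost P + d := by
  induction d generalizing l k with
  | zero =>
    have : l = [] := List.length_eq_zero_iff.1 (by simpa using hl)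
    subst this
    exact ⟨[], by simp, rfl, le_rfl⟩
  | succ d ih =>
    have happ := List.take_append_drop (l.length / 2) l
    have hlen1 : (l.take (l.length / 2)).length = l.length / 2 := by
      rw [List.length_take]; omega
    have hlen2 : (l.drop (l.length / 2)).length = l.length - l.length / 2 := List.length_drop
    rw [bisect]
    rw [pow_succ] at hl
    generalize l.take (l.length / 2) = l₁ at *
    generalize l.drop (l.length / 2) = l₂ at *
    rcases l₂ with _ | ⟨x, r⟩
    · have : l = [] := List.length_eq_zero_iff.1 (by rw [List.length_nil] at hlen2; omega)
      subst this
      exact ⟨[], by simp, rfl, Nat.le_add_right _ _⟩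
    · subst happ
      rw [List.length_cons] at hlen2
      have hx : G.Adj v x := hadj x (by simp)
      simp only [hx, dite_true]
      rw [List.pairwise_append, List.pairwise_cons] at hmono
      obtain ⟨hm1, ⟨hmx, hm2⟩, hm12⟩ := hmono
      by_cases ha : answer P v x = t
      · obtain ⟨s, hs, hres, hcost⟩ := ih l₁ (fun s => k (s ++ x :: r)) (by omega)
          (fun y hy => hadj y (by simp [hy])) hm1
        refine ⟨s ++ x :: r, ?_, ?_, ?_⟩
        · intro y
          have h2 : y ∈ x :: r → answer P v y = t := by
            rintro (_ | ⟨_, hy⟩)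
            · exact ha
            · exact hmx y hy ha
          simp only [List.mem_append, hs]
          tauto
        · simp only [QueryTree.result, ha, if_true]
          exact hres
        · simp only [QueryTree.cost, ha, if_true]
          omega
      · obtain ⟨s, hs, hres, hcost⟩ := ih r k (by omega)
          (fun y hy => hadj y (by simp [hy])) hm2
        refine ⟨s, ?_, ?_, ?_⟩
        · intro y
          have h1 : y ∈ l₁ → answer P v y ≠ t := fun hy h => ha (hm12 y hy x (by simp) h)
          have h2 : y = x → answer P v y ≠ t := fun h => h ▸ ha
          simp only [List.mem_append, List.mem_cons, hs]
          tauto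
        · simp only [QueryTree.result, ha, if_false]
          exact hres
        · simp only [QueryTree.cost, ha, if_false]
          omega

/-- Locate `v` in every chain of a list of chains by two binary searches; pass to `k` the elements
above `v` and the elements below `v`. -/
noncomputable def locate (d : ℕ) (v : V) :
    List (List V) → (List V → List V → QueryTree G) → QueryTree G
  | [], k => k [] []
  | l :: ls, k =>
    bisect v .less d l fun s => bisect v .greater d l.reverse fun t =>
      locate d v ls fun s' t' => k (s ++ s') (t ++ t')

theorem locate_spec (P : PartialOrder V) (d : ℕ) (v : V) (ls : List (List V))
    (k : List V → List V → QueryTree G)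
    (h : ∀ l ∈ ls, l.length < 2 ^ d ∧ (∀ x ∈ l, G.Adj v x) ∧ l.Pairwise P.lt) :
    ∃ s t : List V, (∀ x, x ∈ s ↔ (∃ l ∈ ls, x ∈ l) ∧ P.lt v x) ∧
      (∀ x, x ∈ t ↔ (∃ l ∈ ls, x ∈ l) ∧ P.lt x v) ∧
      (locate d v ls k).result P = (k s t).result P ∧
      (locate d v ls k).cost P ≤ (k s t).cost P + ls.length * (2 * d) := by
  induction ls generalizing k with
  | nil => exact ⟨[], [], by simp, by simp, rfl, by simp [locate]⟩
  | cons l ls ih =>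
    obtain ⟨hlen, hadj, hpw⟩ := h l (by simp)
    have hup : l.Pairwise fun x y => answer P v x = .less → answer P v y = .less := by
      refine hpw.imp fun {x y} hxy hx => ?_
      rw [answer_eq_less] at hx ⊢
      exact lt_trans hx hxy
    have hdn : l.reverse.Pairwise
        fun x y => answer P v x = .greater → answer P v y = .greater := by
      rw [List.pairwise_reverse]
      refine hpw.imp fun {x y} hxy hx => ?_
      rw [answer_eq_greater] at hx ⊢
      exact lt_trans hxy hx
    rw [locate]
    obtain ⟨s, hs, hsr, hsc⟩ := bisect_spec P v .less d l (fun s =>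
      bisect v .greater d l.reverse fun t =>
        locate d v ls fun s' t' => k (s ++ s') (t ++ t')) hlen hadj hup
    obtain ⟨t, ht, htr, htc⟩ := bisect_spec P v .greater d l.reverse (fun t =>
      locate d v ls fun s' t' => k (s ++ s') (t ++ t')) (by simpa using hlen)
      (by simpa using hadj) hdn
    obtain ⟨s', t', hs', ht', hr, hc⟩ := ih (fun s' t' => k (s ++ s') (t ++ t'))
      fun l' hl' => h l' (by simp [hl'])
    refine ⟨s ++ s', t ++ t', ?_, ?_, ?_, ?_⟩
    · intro x
      simp only [List.mem_append, hs, hs', answer_eq_less, List.mem_cons, exists_eq_or_imp]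
      tauto
    · intro x
      simp only [List.mem_append, ht, ht', answer_eq_greater, List.mem_cons, exists_eq_or_imp,
        List.mem_reverse]
      tauto
    · rw [hsr, htr, hr]
    · have : (l :: ls).length * (2 * d) = ls.length * (2 * d) + 2 * d := by
        rw [List.length_cons]; ring
      omega

/-- The relation `R` between elements of `K` shows that `x` is below `y`, through an element
adjacent to both. -/
def Certified (G : SimpleGraph V) (K : Finset V) (R : V → V → Prop) (x y : V) : Prop :=
  ∃ a ∈ K, G.Adj x a ∧ G.Adj a y ∧ R x a ∧ R a y

/-- A cover of the neighbours of `v` in `K` by lists that are increasing for the certified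
relation. -/
def IsChainCover (G : SimpleGraph V) (K : Finset V) (R : V → V → Prop) (v : V)
    (ls : List (List V)) : Prop :=
  (∀ l ∈ ls, l.Pairwise (Certified G K R) ∧ ∀ x ∈ l, x ∈ K ∧ G.Adj v x) ∧
    ∀ x ∈ K, G.Adj v x → ∃ l ∈ ls, x ∈ l

theorem exists_minimal_chainCover (G : SimpleGraph V) (K : Finset V) (R : V → V → Prop) (v : V) :
    ∃ ls, IsChainCover G K R v ls ∧ ∀ ls', IsChainCover G K R v ls' → ls.length ≤ ls'.length := by
  classical
  have hne : {ls | IsChainCover G K R v ls}.Nonempty := by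
    refine ⟨(K.filter fun x => G.Adj v x).toList.map fun x => [x], ?_, ?_⟩
    · intro l hl
      obtain ⟨x, hx, rfl⟩ := List.mem_map.1 hl
      simpa using hx
    · intro x hx hv
      exact ⟨[x], List.mem_map.2 ⟨x, by simp [hx, hv], rfl⟩, by simp⟩
  exact ⟨Function.argminOn List.length _ hne, Function.argminOn_mem List.length _ hne,
    fun ls' h => Function.argminOn_le List.length _ h⟩

/-- A chain cover of the neighbours of `v` in `K` with as few chains as possible. -/
noncomputable def chainCover (G : SimpleGraph V) (K : Finset V) (R : V → V → Prop) (v : V) :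
    List (List V) :=
  (exists_minimal_chainCover G K R v).choose

theorem chainCover_spec (G : SimpleGraph V) (K : Finset V) (R : V → V → Prop) (v : V) :
    IsChainCover G K R v (chainCover G K R v) :=
  (exists_minimal_chainCover G K R v).choose_spec.1

theorem length_chainCover_le {K : Finset V} {R : V → V → Prop} {v : V} {ls : List (List V)}
    (h : IsChainCover G K R v ls) : (chainCover G K R v).length ≤ ls.length :=
  (exists_minimal_chainCover G K R v).choose_spec.2 ls h

/-- The part of the order of `P` that the queries inside `K` reveal directly. -/
def known (G : SimpleGraph V) (P : PartialOrder V) (K : Finset V) (x y : V) : Prop :=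
  x ∈ K ∧ y ∈ K ∧ G.Adj x y ∧ P.lt x y

/-- The poset that satisfies the promise with `G` and in which the comparable adjacent pairs are
given by `R` (an arbitrary poset if there is none). -/
@[reducible] noncomputable def reconstruct (G : SimpleGraph V) (R : V → V → Prop) : PartialOrder V :=
  @Classical.epsilon _ ⟨orderOfLt (fun _ _ => False) (fun _ h => h) fun _ _ _ h _ => h⟩
    fun P => IsInstance G P ∧ ∀ x y, R x y ↔ G.Adj x y ∧ P.lt x y

theorem reconstruct_eq {P : PartialOrder V} (hP : IsInstance G P) {R : V → V → Prop}
    (hR : ∀ x y, R x y ↔ G.Adj x y ∧ P.lt x y) : reconstruct G R = P := by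
  have h : ∃ P : PartialOrder V, IsInstance G P ∧ ∀ x y, R x y ↔ G.Adj x y ∧ P.lt x y :=
    ⟨P, hP, hR⟩
  obtain ⟨h1, h2⟩ := Classical.epsilon_spec h
  refine PartialOrder.ext_lt fun x y => ?_
  have hrel : (fun x y => G.Adj x y ∧ (reconstruct G R).lt x y) =
      fun x y => G.Adj x y ∧ P.lt x y := by
    funext x y
    exact propext ((h2 x y).symm.trans (hR x y))
  refine (h1 x y).trans ?_
  refine Iff.trans ?_ (hP x y).symm
  exact iff_of_eq (congrArg (fun r => Relation.TransGen r x y) hrel)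

open Classical in
/-- Insert the vertices of a list, one after the other, into the set `K` of the vertices among
which the order is known; `R` is that order. -/
noncomputable def insertAll (d : ℕ) : List V → Finset V → (V → V → Prop) → QueryTree G
  | [], _, R => .output (reconstruct G R)
  | v :: o, K, R => locate d v (chainCover G K R v) fun s t =>
      insertAll d o (insert v K) fun x y => R x y ∨ (x = v ∧ y ∈ s) ∨ (x ∈ t ∧ y = v)

theorem lt_of_certified {P : PartialOrder V} {K : Finset V} {x y : V}
    (h : Certified G K (known G P K) x y) : P.lt x y := by
  obtain ⟨a, -, -, -, h1, h2⟩ := h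
  exact lt_trans h1.2.2.2 h2.2.2.2

theorem insertAll_spec [Fintype V] {P : PartialOrder V} (hP : IsInstance G P) {d r : ℕ}
    (hd : Fintype.card V < 2 ^ d) (o : List V) (K : Finset V)
    (hr : ∀ o₁ v o₂, o = o₁ ++ v :: o₂ → ∀ K' : Finset V, (∀ x, x ∈ K' ↔ x ∈ K ∨ x ∈ o₁) →
      (chainCover G K' (known G P K') v).length ≤ r)
    (hK : ∀ x, x ∈ K ∨ x ∈ o) :
    (insertAll d o K (known G P K) : QueryTree G).result P = P ∧
      (insertAll d o K (known G P K) : QueryTree G).cost P ≤ o.length * (r * (2 * d)) := by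
  classical
  induction o generalizing K with
  | nil =>
    refine ⟨reconstruct_eq hP fun x y => ?_, le_of_eq (by simp [insertAll, QueryTree.cost])⟩
    have : ∀ x, x ∈ K := by simpa using hK
    simp [known, this]
  | cons v o ih =>
    rw [insertAll]
    obtain ⟨hcov1, hcov2⟩ := chainCover_spec G K (known G P K) v
    have hmem : ∀ x, (∃ l ∈ chainCover G K (known G P K) v, x ∈ l) ↔ x ∈ K ∧ G.Adj v x :=
      fun x => ⟨fun ⟨l, hl, hx⟩ => (hcov1 l hl).2 x hx, fun h => hcov2 x h.1 h.2⟩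
    obtain ⟨s, t, hs, ht, hres, hcost⟩ := locate_spec P d v (chainCover G K (known G P K) v)
      (fun s t => insertAll d o (insert v K)
        fun x y => known G P K x y ∨ (x = v ∧ y ∈ s) ∨ (x ∈ t ∧ y = v)) (by
      intro l hl
      have hpw : l.Pairwise P.lt := (hcov1 l hl).1.imp lt_of_certified
      refine ⟨lt_of_le_of_lt ?_ hd, fun x hx => ((hcov1 l hl).2 x hx).2, hpw⟩
      have hnd : l.Nodup := hpw.imp fun {x y} h => ne_of_lt h
      exact hnd.length_le_card)
    have hknown : (fun x y => known G P K x y ∨ (x = v ∧ y ∈ s) ∨ (x ∈ t ∧ y = v)) =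
        known G P (insert v K) := by
      funext x y
      apply propext
      simp only [hs, ht, hmem, known, Finset.mem_insert]
      constructor
      · rintro (h | ⟨rfl, h⟩ | ⟨h, rfl⟩)
        · tauto
        · tauto
        · exact ⟨Or.inr h.1.1, Or.inl rfl, h.1.2.symm, h.2⟩
      · rintro ⟨rfl | hx, rfl | hy, hadj, hlt⟩
        · exact absurd hadj (G.loopless.irrefl _)
        · tauto
        · exact Or.inr (Or.inr ⟨⟨⟨hx, hadj.symm⟩, hlt⟩, rfl⟩)
        · tauto
    rw [hknown] at hres hcost
    have hfirst : (chainCover G K (known G P K) v).length ≤ r :=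
      hr [] v o rfl K (by simp)
    obtain ⟨ih1, ih2⟩ := ih (insert v K) (by
      intro o₁ u o₂ ho K' hK'
      refine hr (v :: o₁) u o₂ (by rw [ho]; rfl) K' fun x => ?_
      rw [hK', Finset.mem_insert, List.mem_cons]
      tauto) (by
      intro x
      have := hK x
      simp only [List.mem_cons, Finset.mem_insert] at this ⊢
      tauto)
    refine ⟨hres.trans ih1, hcost.trans ?_⟩
    have h1 : (v :: o).length * (r * (2 * d)) = o.length * (r * (2 * d)) + r * (2 * d) := by
      rw [List.length_cons]; ring
    have h2 := Nat.mul_le_mul_right (2 * d) hfirst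
    omega

end

/-! ### Random insertion orders -/

open Classical in
/-- The exchange of `w` and `f w` for all `w ∈ ε`. -/
noncomputable def flip {V : Type} (f : V → V) (ε : Finset V) (x : V) : V :=
  if x ∈ ε then f x else if h : ∃ w ∈ ε, f w = x then h.choose else x

theorem flip_of_mem {V : Type} {f : V → V} {ε : Finset V} {w : V} (hw : w ∈ ε) :
    flip f ε w = f w := by
  simp [flip, hw]

theorem flip_apply {V : Type} {f : V → V} {ε : Finset V} (hinj : Set.InjOn f ε)
    (hdisj : ∀ w ∈ ε, f w ∉ ε) {w : V} (hw : w ∈ ε) : flip f ε (f w) = w := by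
  have h : ∃ w' ∈ ε, f w' = f w := ⟨w, hw, rfl⟩
  simp only [flip, hdisj w hw, if_false, h, dite_true]
  exact hinj h.choose_spec.1 hw h.choose_spec.2

theorem flip_of_notMem {V : Type} {f : V → V} {ε : Finset V} {x : V} (hx : x ∉ ε)
    (hfx : ∀ w ∈ ε, f w ≠ x) : flip f ε x = x := by
  have h : ¬ ∃ w ∈ ε, f w = x := by push Not; exact hfx
  simp [flip, hx, h]

theorem flip_involutive {V : Type} {f : V → V} {ε : Finset V} (hinj : Set.InjOn f ε)
    (hdisj : ∀ w ∈ ε, f w ∉ ε) : Function.Involutive (flip f ε) := by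
  intro x
  by_cases hx : x ∈ ε
  · rw [flip_of_mem hx, flip_apply hinj hdisj hx]
  · by_cases h : ∃ w ∈ ε, f w = x
    · obtain ⟨w, hw, rfl⟩ := h
      rw [flip_apply hinj hdisj hw, flip_of_mem hw]
    · push Not at h
      rw [flip_of_notMem hx h, flip_of_notMem hx h]

/-- For a uniformly random order `σ`, it is unlikely that at time `τ` many elements `w` of `W` have
been inserted, but none of their partners `f w`: the `2 ^ L` orders that arise from such an order by
exchanging some of the inserted elements with their partners are distinct, as the inserted partners
show which exchanges took place. -/
theorem card_unpaired_mul_le {n : ℕ} (W : Finset (Fin n)) (f : Fin n → Fin n)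
    (hinj : Set.InjOn f W) (hdisj : ∀ w ∈ W, f w ∉ W) (τ : Fin n) (L : ℕ) :
    (Finset.univ.filter fun σ : Equiv.Perm (Fin n) =>
      (∀ w ∈ W, τ ≤ σ (f w)) ∧ L ≤ (W.filter fun w => σ w < τ).card).card * 2 ^ L ≤
      Fintype.card (Equiv.Perm (Fin n)) := by
  classical
  set B := Finset.univ.filter fun σ : Equiv.Perm (Fin n) =>
      (∀ w ∈ W, τ ≤ σ (f w)) ∧ L ≤ (W.filter fun w => σ w < τ).card with hB
  let T : Equiv.Perm (Fin n) → Finset (Fin n) := fun σ => W.filter fun w => σ w < τ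
  let S : Finset (Σ _ : Equiv.Perm (Fin n), Finset (Fin n)) := B.sigma fun σ => (T σ).powerset
  have hS : B.card * 2 ^ L ≤ S.card := by
    rw [Finset.card_sigma, ← smul_eq_mul]
    refine Finset.card_nsmul_le_sum _ _ _ fun σ hσ => ?_
    rw [Finset.card_powerset]
    exact Nat.pow_le_pow_right two_pos (Finset.mem_filter.1 hσ).2.2
  refine hS.trans ?_
  have hsub : ∀ p ∈ S, p.2 ⊆ W := fun p hp =>
    (Finset.mem_powerset.1 (Finset.mem_sigma.1 hp).2).trans (Finset.filter_subset _ _)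
  have hinv : ∀ p ∈ S, Function.Involutive (flip f p.2) := fun p hp =>
    flip_involutive (hinj.mono (hsub p hp)) fun w hw h => hdisj w (hsub p hp hw) (hsub p hp h)
  let F : (Σ _ : Equiv.Perm (Fin n), Finset (Fin n)) → Equiv.Perm (Fin n) := fun p =>
    if h : Function.Involutive (flip f p.2) then h.toPerm.trans p.1 else 1
  have hF : ∀ p ∈ S, ∀ x, F p x = p.1 (flip f p.2 x) := by
    intro p hp x
    simp only [F, hinv p hp, dite_true]
    rfl
  rw [← Finset.card_univ]
  refine Finset.card_le_card_of_injOn F (fun _ _ => Finset.mem_univ _) ?_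
  have hrec : ∀ p ∈ S, p.2 = W.filter fun w => F p (f w) < τ := by
    intro p hp
    obtain ⟨hpB, hpT⟩ := Finset.mem_sigma.1 hp
    have hpB := (Finset.mem_filter.1 hpB).2
    ext w
    rw [Finset.mem_filter, hF p hp]
    constructor
    · intro hw
      rw [flip_apply (hinj.mono (hsub p hp))
        (fun w hw h => hdisj w (hsub p hp hw) (hsub p hp h)) hw]
      exact Finset.mem_filter.1 (Finset.mem_powerset.1 hpT hw)
    · rintro ⟨hw, hlt⟩
      by_contra hne
      rw [flip_of_notMem (fun h => hdisj w hw (hsub p hp h)) fun w' hw' h =>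
        hne (hinj (hsub p hp hw') hw h ▸ hw')] at hlt
      exact absurd hlt (not_lt.2 (hpB.1 w hw))
  intro p hp q hq hpq
  have h2 : p.2 = q.2 := by rw [hrec p hp, hrec q hq, hpq]
  have h1 : p.1 = q.1 := by
    ext x
    have hx : F p (flip f p.2 x) = F q (flip f q.2 x) := by rw [hpq, h2]
    rw [hF p hp, hF q hq, hinv p hp, hinv q hq] at hx
    rw [hx]
  exact Sigma.ext h1 (heq_of_eq h2)

/-! ### The number of chains in the certified order -/

theorem exists_sorted_list {V : Type} (P : PartialOrder V) (D : Finset V)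
    (hD : ∀ x ∈ D, ∀ y ∈ D, x ≠ y → P.lt x y ∨ P.lt y x) :
    ∃ l : List V, l.Pairwise P.lt ∧ ∀ x, x ∈ l ↔ x ∈ D := by
  classical
  induction D using Finset.strongInduction with
  | H D ih =>
  rcases D.eq_empty_or_nonempty with rfl | hne
  · exact ⟨[], by simp, by simp⟩
  obtain ⟨a, ha⟩ := D.exists_maximal hne
  obtain ⟨l, hl, hmem⟩ := ih _ (Finset.erase_ssubset ha.prop) fun x hx y hy =>
    hD x (Finset.mem_of_mem_erase hx) y (Finset.mem_of_mem_erase hy)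
  refine ⟨l ++ [a], ?_, ?_⟩
  · rw [List.pairwise_append]
    refine ⟨hl, by simp, fun x hx y hy => ?_⟩
    rw [List.mem_singleton] at hy
    subst hy
    have hx := Finset.mem_erase.1 ((hmem x).1 hx)
    exact (hD x hx.2 y ha.prop hx.1).resolve_right (ha.not_gt hx.2)
  · intro x
    have := ha.prop
    by_cases h : x = a <;> simp_all

open Classical in
/-- If `x < y` in a chain are certified to be comparable whenever at least `L` elements of `K` on their
side lie in the part `[x, y)` of the chain, then every chain falls apart into at most `L` certified
ones. -/
theorem length_chainCover_le_mul {V : Type} [Fintype V] {G : SimpleGraph V} {P : PartialOrder V}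
    {χ : V → ℕ} {k L : ℕ} (hL : 0 < L) (hχ : ∀ x, χ x < k)
    (hcomp : ∀ x y, χ x = χ y → x ≠ y → P.lt x y ∨ P.lt y x) (K : Finset V) (v : V)
    (h : ∀ x ∈ K, ∀ y ∈ K, G.Adj v x → G.Adj v y → χ x = χ y → P.lt x y →
      L ≤ (K.filter fun w => G.Adj v w ∧ χ w = χ x ∧ P.le x w ∧ P.lt w y).card →
      Certified G K (known G P K) x y) :
    (chainCover G K (known G P K) v).length ≤ k * L := by
  -- split the chain of `x` according to the residue mod `L` of the position `ρ x` of `x` in it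
  let ρ : V → ℕ := fun x => (K.filter fun w => G.Adj v w ∧ χ w = χ x ∧ P.lt w x).card
  let D : ℕ → Finset V := fun i => K.filter fun x => G.Adj v x ∧ χ x * L + ρ x % L = i
  have hcode : ∀ x y, χ x * L + ρ x % L = χ y * L + ρ y % L → χ x = χ y ∧ ρ x % L = ρ y % L := by
    intro x y hxy
    have hx := Nat.mod_lt (ρ x) hL
    have hy := Nat.mod_lt (ρ y) hL
    have h1 : (χ x * L + ρ x % L) / L = χ x := by
      rw [mul_comm, Nat.mul_add_div hL, Nat.div_eq_of_lt hx, add_zero]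
    have h2 : (χ y * L + ρ y % L) / L = χ y := by
      rw [mul_comm, Nat.mul_add_div hL, Nat.div_eq_of_lt hy, add_zero]
    have h3 : χ x = χ y := by rw [← h1, ← h2, hxy]
    exact ⟨h3, by rw [h3] at hxy; omega⟩
  have hsort : ∀ i, ∃ l : List V, l.Pairwise P.lt ∧ ∀ x, x ∈ l ↔ x ∈ D i := by
    intro i
    refine exists_sorted_list P _ fun x hx y hy => hcomp x y ?_
    exact (hcode x y ((Finset.mem_filter.1 hx).2.2.trans (Finset.mem_filter.1 hy).2.2.symm)).1
  choose l hl hmem using hsort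
  have hcert : ∀ i, ∀ x ∈ D i, ∀ y ∈ D i, P.lt x y → Certified G K (known G P K) x y := by
    intro i x hx y hy hxy
    obtain ⟨hxK, hvx, hxi⟩ := Finset.mem_filter.1 hx
    obtain ⟨hyK, hvy, hyi⟩ := Finset.mem_filter.1 hy
    obtain ⟨hχxy, hmod⟩ := hcode x y (hxi.trans hyi.symm)
    refine h x hxK y hyK hvx hvy hχxy hxy ?_
    have hsum : ρ x + (K.filter fun w => G.Adj v w ∧ χ w = χ x ∧ P.le x w ∧ P.lt w y).card
        = ρ y := by
      rw [← Finset.card_union_of_disjoint]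
      · congr 1
        ext w
        simp only [Finset.mem_union, Finset.mem_filter, hχxy]
        constructor
        · rintro (⟨h1, h2, h3, h4⟩ | ⟨h1, h2, h3, -, h5⟩)
          · exact ⟨h1, h2, h3, lt_trans h4 hxy⟩
          · exact ⟨h1, h2, h3, h5⟩
        · rintro ⟨h1, h2, h3, h4⟩
          by_cases hwx : w = x
          · exact Or.inr ⟨h1, h2, h3, hwx ▸ le_rfl, h4⟩
          · rcases hcomp w x (h3.trans hχxy.symm) hwx with h5 | h5
            · exact Or.inl ⟨h1, h2, h3, h5⟩
            · exact Or.inr ⟨h1, h2, h3, le_of_lt h5, h4⟩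
      · rw [Finset.disjoint_left]
        intro w hw hw'
        exact absurd (Finset.mem_filter.1 hw).2.2.2
          (not_lt_of_ge (Finset.mem_filter.1 hw').2.2.2.1)
    set m := (K.filter fun w => G.Adj v w ∧ χ w = χ x ∧ P.le x w ∧ P.lt w y).card
    have hm : 0 < m := Finset.card_pos.2
      ⟨x, Finset.mem_filter.2 ⟨hxK, hvx, rfl, P.le_refl x, hxy⟩⟩
    have hdvd : L ∣ m := by
      have : ρ x ≡ ρ x + m [MOD L] := by rw [hsum]; exact hmod
      exact (Nat.modEq_iff_dvd' (Nat.le_add_right _ _)).1 this |>.trans (by simp)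
    exact Nat.le_of_dvd hm hdvd
  have hcov : IsChainCover G K (known G P K) v ((List.range (k * L)).map l) := by
    refine ⟨?_, ?_⟩
    · intro l' hl'
      obtain ⟨i, -, rfl⟩ := List.mem_map.1 hl'
      refine ⟨(hl i).imp_of_mem fun {x y} hx hy hxy =>
        hcert i x ((hmem i x).1 hx) y ((hmem i y).1 hy) hxy, fun x hx => ?_⟩
      have := Finset.mem_filter.1 ((hmem i x).1 hx)
      exact ⟨this.1, this.2.1⟩
    · intro x hx hv
      refine ⟨l (χ x * L + ρ x % L), List.mem_map.2 ⟨_, List.mem_range.2 ?_, rfl⟩,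
        (hmem _ x).2 (Finset.mem_filter.2 ⟨hx, hv, rfl⟩)⟩
      have h1 := Nat.mod_lt (ρ x) hL
      have h2 : (χ x + 1) * L ≤ k * L := Nat.mul_le_mul_right L (hχ x)
      rw [add_mul, one_mul] at h2
      omega
  exact (length_chainCover_le hcov).trans (by simp)

/-! ### The upper bound -/

theorem exists_between {V : Type} {G : SimpleGraph V} {P : PartialOrder V} {s : Set V}
    (hs : ∀ u v : V, G.Adj u v ↔ (u ∈ s ∧ v ∉ s) ∨ (u ∉ s ∧ v ∈ s)) (hP : IsInstance G P)
    {x y : V} (hxy : P.lt x y) (hside : x ∈ s ↔ y ∈ s) :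
    ∃ a, G.Adj x a ∧ P.lt x a ∧ P.lt a y := by
  obtain ⟨a, ⟨hadj, hlt⟩, hay⟩ := Relation.TransGen.head'_iff.1 ((hP x y).1 hxy)
  refine ⟨a, hadj, hlt, ?_⟩
  rcases Relation.reflTransGen_iff_eq_or_transGen.1 hay with rfl | h
  · have := (hs x y).1 hadj
    tauto
  · exact (hP a y).2 h

/-- Every element `w` can be given a partner on the other side that lies between `w` and the next
element of the chain of `w` on the side of `w`. -/
theorem exists_partner {V : Type} [Fintype V] {G : SimpleGraph V} {P : PartialOrder V} {s : Set V}
    (hs : ∀ u v : V, G.Adj u v ↔ (u ∈ s ∧ v ∉ s) ∨ (u ∉ s ∧ v ∈ s)) (hP : IsInstance G P)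
    {χ : V → ℕ} (hcomp : ∀ x y, χ x = χ y → x ≠ y → P.lt x y ∨ P.lt y x) :
    ∃ f : V → V, ∀ w y, χ w = χ y → (w ∈ s ↔ y ∈ s) → P.lt w y →
      G.Adj w (f w) ∧ P.lt w (f w) ∧ P.lt (f w) y := by
  classical
  have : ∀ w, ∃ a, ∀ y, χ w = χ y → (w ∈ s ↔ y ∈ s) → P.lt w y →
      G.Adj w a ∧ P.lt w a ∧ P.lt a y := by
    intro w
    let D := Finset.univ.filter fun y => χ w = χ y ∧ (w ∈ s ↔ y ∈ s) ∧ P.lt w y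
    rcases D.eq_empty_or_nonempty with hD | hD
    · refine ⟨w, fun y h1 h2 h3 => ?_⟩
      have : y ∈ D := Finset.mem_filter.2 ⟨Finset.mem_univ _, h1, h2, h3⟩
      simp [hD] at this
    · obtain ⟨z, hz⟩ := D.exists_minimal hD
      have hzD := (Finset.mem_filter.1 hz.prop).2
      obtain ⟨a, ha1, ha2, ha3⟩ := exists_between hs hP hzD.2.2 hzD.2.1
      refine ⟨a, fun y h1 h2 h3 => ⟨ha1, ha2, ?_⟩⟩
      by_cases hyz : z = y
      · exact hyz ▸ ha3
      · rcases hcomp z y (hzD.1.symm.trans h1) hyz with h | h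
        · exact lt_trans ha3 h
        · exact absurd h (hz.not_lt (Finset.mem_filter.2 ⟨Finset.mem_univ _, h1, h2, h3⟩))
  choose f hf using this
  exact ⟨f, hf⟩

/-- The insertion algorithm for the insertion order `σ`. -/
noncomputable def insertionTree {n : ℕ} (G : SimpleGraph (Fin n)) (σ : Equiv.Perm (Fin n)) :
    QueryTree G :=
  insertAll (Nat.log 2 n + 1) (List.ofFn σ.symm) ∅ fun _ _ => False

/-- All but a fraction `n ^ 3 / 2 ^ L` of the insertion orders lead to the correct output at a small
cost. -/
theorem exists_bad_orders {n : ℕ} {G : SimpleGraph (Fin n)} {P : PartialOrder (Fin n)}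
    (hG : IsCompleteBipartite G) (hP : IsInstance G P) {L : ℕ} (hL : 0 < L) :
    ∃ B : Finset (Equiv.Perm (Fin n)),
      B.card * 2 ^ L ≤ n ^ 3 * Fintype.card (Equiv.Perm (Fin n)) ∧
      ∀ σ ∉ B, (insertionTree G σ).result P = P ∧
        (insertionTree G σ).cost P ≤ n * (width P * L * (2 * (Nat.log 2 n + 1))) := by
  classical
  obtain ⟨s, hs⟩ := hG
  obtain ⟨χ, hχ, hcomp⟩ := exists_chain_coloring P
  obtain ⟨f, hf⟩ := exists_partner hs hP hcomp
  let W : Fin n → Fin n → Finset (Fin n) := fun x y => Finset.univ.filter fun w =>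
    χ w = χ x ∧ χ w = χ y ∧ (w ∈ s ↔ x ∈ s) ∧ (w ∈ s ↔ y ∈ s) ∧ P.le x w ∧ P.lt w y
  have hW : ∀ {x y w}, w ∈ W x y →
      χ w = χ x ∧ χ w = χ y ∧ (w ∈ s ↔ x ∈ s) ∧ (w ∈ s ↔ y ∈ s) ∧ P.le x w ∧ P.lt w y :=
    fun h => (Finset.mem_filter.1 h).2
  have hfW : ∀ {x y w}, w ∈ W x y → G.Adj w (f w) ∧ P.lt w (f w) ∧ P.lt (f w) y :=
    fun h => hf _ _ (hW h).2.1 (hW h).2.2.2.1 (hW h).2.2.2.2.2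
  have hdisj : ∀ x y, ∀ w ∈ W x y, f w ∉ W x y := by
    intro x y w hw hfw
    have h1 := (hs _ _).1 (hfW hw).1
    have h2 := (hW hw).2.2.1
    have h3 := (hW hfw).2.2.1
    tauto
  have hinj : ∀ x y, Set.InjOn f (W x y) := by
    have key : ∀ x y, ∀ w ∈ W x y, ∀ w' ∈ W x y, P.lt w w' → f w ≠ f w' := by
      intro x y w hw w' hw' hlt heq
      have h1 := hW hw
      have h2 := hW hw'
      have h3 : P.lt (f w) w' := (hf w w' (h1.1.trans h2.1.symm) (by tauto) hlt).2.2
      have h4 : P.lt w' (f w') := (hfW hw').2.1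
      exact lt_irrefl _ (heq ▸ lt_trans h3 h4)
    intro x y w hw w' hw' heq
    by_contra hne
    rcases hcomp w w' ((hW hw).1.trans (hW hw').1.symm) hne with h | h
    · exact key x y w hw w' hw' h heq
    · exact key x y w' hw' w hw h heq.symm
  let E : Fin n × Fin n × Fin n → Finset (Equiv.Perm (Fin n)) := fun p =>
    Finset.univ.filter fun σ : Equiv.Perm (Fin n) => (∀ w ∈ W p.1 p.2.1, p.2.2 ≤ σ (f w)) ∧
      L ≤ ((W p.1 p.2.1).filter fun w => σ w < p.2.2).card
  refine ⟨Finset.univ.biUnion E, ?_, ?_⟩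
  · calc (Finset.univ.biUnion E).card * 2 ^ L ≤ (∑ p, (E p).card) * 2 ^ L :=
          Nat.mul_le_mul_right _ Finset.card_biUnion_le
      _ = ∑ p, (E p).card * 2 ^ L := Finset.sum_mul _ _ _
      _ ≤ ∑ _p : Fin n × Fin n × Fin n, Fintype.card (Equiv.Perm (Fin n)) :=
          Finset.sum_le_sum fun p _ =>
            card_unpaired_mul_le _ f (hinj p.1 p.2.1) (hdisj p.1 p.2.1) p.2.2 L
      _ = n ^ 3 * Fintype.card (Equiv.Perm (Fin n)) := by
          rw [Finset.sum_const, Finset.card_univ, smul_eq_mul]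
          simp only [Fintype.card_prod, Fintype.card_fin]
          ring
  · intro σ hσ
    have hgood : ∀ p, σ ∉ E p := fun p hp =>
      hσ (Finset.mem_biUnion.2 ⟨p, Finset.mem_univ _, hp⟩)
    have hempty : (fun _ _ => False : Fin n → Fin n → Prop) = known G P ∅ := by
      funext x y
      simp [known]
    have hall : ∀ x, x ∈ List.ofFn σ.symm := fun x =>
      List.mem_ofFn.2 ⟨σ x, σ.symm_apply_apply x⟩
    have hspec := insertAll_spec hP (d := Nat.log 2 n + 1) (r := width P * L)
      (by rw [Fintype.card_fin]; exact Nat.lt_pow_succ_log_self one_lt_two n)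
      (List.ofFn σ.symm) ∅ ?_ (fun x => Or.inr (hall x))
    · rw [← hempty, List.length_ofFn] at hspec
      exact hspec
    · intro o₁ v o₂ ho K hK
      -- the vertices before `v` are those with an earlier position
      have hpw : (List.ofFn σ.symm).Pairwise fun x y => σ x < σ y := by
        rw [List.pairwise_ofFn]
        intro i j hij
        simpa using hij
      rw [ho, List.pairwise_append, List.pairwise_cons] at hpw
      have hmem : ∀ x, x ∈ K ↔ σ x < σ v := by
        intro x
        have hx : x ∈ o₁ ++ v :: o₂ := ho ▸ hall x
        have hxK : x ∈ K ↔ x ∈ o₁ := by simpa using hK x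
        rw [hxK]
        refine ⟨fun h => hpw.2.2 x h v (by simp), fun h => ?_⟩
        rcases List.mem_append.1 hx with h' | h'
        · exact h'
        · rcases List.mem_cons.1 h' with rfl | h'
          · exact absurd h (Nat.lt_irrefl _)
          · exact absurd h (Nat.lt_asymm (hpw.2.1.1 x h'))
      refine length_chainCover_le_mul hL hχ hcomp K v ?_
      intro x hx y hy hvx hvy hχxy hxy hcard
      have hside : ∀ {w}, G.Adj v w → (w ∈ s ↔ x ∈ s) ∧ (w ∈ s ↔ y ∈ s) := by
        intro w hw
        have h1 := (hs _ _).1 hw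
        have h2 := (hs _ _).1 hvx
        have h3 := (hs _ _).1 hvy
        tauto
      have hnot := hgood (x, y, σ v)
      have hle : L ≤ ((W x y).filter fun w => σ w < σ v).card := by
        refine hcard.trans (Finset.card_le_card fun w hw => ?_)
        obtain ⟨hwK, hvw, hχw, hxw, hwy⟩ := Finset.mem_filter.1 hw
        exact Finset.mem_filter.2 ⟨Finset.mem_filter.2 ⟨Finset.mem_univ _, hχw, hχw.trans hχxy,
          (hside hvw).1, (hside hvw).2, hxw, hwy⟩, (hmem w).1 hwK⟩
      have : ∃ w ∈ W x y, σ (f w) < σ v := by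
        by_contra hno
        push Not at hno
        exact hnot (Finset.mem_filter.2 ⟨Finset.mem_univ _, hno, hle⟩)
      obtain ⟨w, hw, hwv⟩ := this
      obtain ⟨ha1, ha2, ha3⟩ := hfW hw
      have hfK : f w ∈ K := (hmem _).2 hwv
      have hxa : G.Adj x (f w) := by
        rw [hs] at ha1 ⊢
        have := (hW hw).2.2.1
        tauto
      have hay : G.Adj (f w) y := by
        rw [hs] at ha1 ⊢
        have := (hW hw).2.2.2.1
        tauto
      exact ⟨f w, hfK, hxa, hay, ⟨hx, hfK, hxa, lt_of_le_of_lt (hW hw).2.2.2.2.1 ha2⟩,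
        hfK, hy, hay, ha3⟩

/-- Inserting the vertices in a uniformly random order. -/
noncomputable def randomInsertion (n : ℕ) (G : SimpleGraph (Fin n)) : RandomizedAlgorithm G :=
  (PMF.uniformOfFintype (Equiv.Perm (Fin n))).map (insertionTree G)

theorem one_sub_le_successProb_randomInsertion {n : ℕ} {G : SimpleGraph (Fin n)}
    {P : PartialOrder (Fin n)} {q δ : ℝ} (B : Finset (Equiv.Perm (Fin n)))
    (hB : (B.card : ℝ) ≤ δ * Fintype.card (Equiv.Perm (Fin n)))
    (h : ∀ σ ∉ B, (insertionTree G σ).result P = P ∧ ((insertionTree G σ).cost P : ℝ) ≤ q) :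
    1 - δ ≤ successProb (randomInsertion n G) P q := by
  classical
  have hN : (0 : ℝ) < Fintype.card (Equiv.Perm (Fin n)) := by exact_mod_cast Fintype.card_pos
  unfold successProb randomInsertion
  rw [PMF.toOuterMeasure_map_apply]
  set S := insertionTree G ⁻¹' {t | t.result P = P ∧ (t.cost P : ℝ) ≤ q}
  have hsub : ((Bᶜ : Finset _) : Set (Equiv.Perm (Fin n))) ⊆ S := fun σ hσ =>
    h σ (by simpa using hσ)
  rw [PMF.toOuterMeasure_uniformOfFintype_apply, ENNReal.toReal_div, ENNReal.toReal_natCast,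
    ENNReal.toReal_natCast, le_div_iff₀ hN]
  have h1 : (Bᶜ).card ≤ Fintype.card S := by
    rw [← Set.toFinset_card]
    exact Finset.card_le_card fun σ hσ => Set.mem_toFinset.2 (hsub hσ)
  have h2 : (Bᶜ).card + B.card = Fintype.card (Equiv.Perm (Fin n)) := by
    rw [add_comm, Finset.card_add_card_compl]
  have h1' : ((Bᶜ).card : ℝ) ≤ Fintype.card S := by exact_mod_cast h1
  have h2' : ((Bᶜ).card : ℝ) + B.card = Fintype.card (Equiv.Perm (Fin n)) := by exact_mod_cast h2
  linarith

theorem width_pos {n : ℕ} (hn : 0 < n) (P : PartialOrder (Fin n)) : 0 < width P := by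
  obtain ⟨χ, hχ, -⟩ := exists_chain_coloring P
  exact (Nat.zero_le _).trans_lt (hχ ⟨0, hn⟩)

theorem upper_bound (c : ℕ) : ∃ C : ℝ, 0 < C ∧
    ∀ (n k : ℕ) (G : SimpleGraph (Fin n)) (P : PartialOrder (Fin n)),
      2 ≤ n → IsCompleteBipartite G → IsInstance G P → width P = k →
        1 - 1 / (n : ℝ) ^ c ≤ successProb (randomInsertion n G) P
          (C * ((n : ℝ) * k) * Real.log ((n : ℝ) * k) ^ 2) := by
  have hlog2 : 0 < Real.log 2 := Real.log_pos one_lt_two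
  refine ⟨8 * (c + 3) / Real.log 2 ^ 2, by positivity, ?_⟩
  intro n k G P hn hG hP hk
  have hk0 : 0 < k := hk ▸ width_pos (by omega) P
  set d := Nat.log 2 n + 1 with hd
  -- with `L = (c + 3) d`, the fraction of bad orders is at most `n ^ 3 / n ^ (c + 3)`
  obtain ⟨B, hB, hgood⟩ := exists_bad_orders hG hP (L := (c + 3) * d) (by positivity)
  rw [hk] at hgood
  have hn0 : (0 : ℝ) < n := by exact_mod_cast (by omega : 0 < n)
  refine one_sub_le_successProb_randomInsertion B ?_ fun σ hσ => ⟨(hgood σ hσ).1, ?_⟩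
  · have h1 : n ^ (c + 3) ≤ 2 ^ ((c + 3) * d) := by
      rw [mul_comm (c + 3) d, pow_mul]
      exact Nat.pow_le_pow_left (Nat.lt_pow_succ_log_self one_lt_two n).le _
    have h2 : B.card * n ^ c * n ^ 3 ≤ Fintype.card (Equiv.Perm (Fin n)) * n ^ 3 := by
      calc B.card * n ^ c * n ^ 3 = B.card * n ^ (c + 3) := by ring
        _ ≤ B.card * 2 ^ ((c + 3) * d) := Nat.mul_le_mul_left _ h1
        _ ≤ _ := hB
        _ = _ := mul_comm _ _
    have h3 : B.card * n ^ c ≤ Fintype.card (Equiv.Perm (Fin n)) :=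
      Nat.le_of_mul_le_mul_right h2 (by positivity)
    rw [one_div, inv_mul_eq_div, le_div_iff₀ (by positivity)]
    exact_mod_cast h3
  · have hcost : ((insertionTree G σ).cost P : ℝ) ≤ n * (k * ((c + 3) * d) * (2 * d)) := by
      exact_mod_cast (hgood σ hσ).2
    have hdlog : (d : ℝ) * Real.log 2 ≤ 2 * Real.log (n * k) := by
      have h1 : (Nat.log 2 n : ℝ) * Real.log 2 ≤ Real.log n := by
        rw [← Real.log_pow]
        refine Real.log_le_log (by positivity) ?_
        exact_mod_cast Nat.pow_log_le_self 2 (by omega : n ≠ 0)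
      have h2 : Real.log 2 ≤ Real.log n := Real.log_le_log two_pos (by exact_mod_cast hn)
      have h3 : Real.log n ≤ Real.log (n * k) := by
        refine Real.log_le_log hn0 (le_mul_of_one_le_right hn0.le ?_)
        exact_mod_cast hk0
      rw [hd]
      push_cast
      linarith
    have hsq : ((d : ℝ) * Real.log 2) ^ 2 ≤ (2 * Real.log (n * k)) ^ 2 :=
      pow_le_pow_left₀ (by positivity) hdlog 2
    refine hcost.trans ?_
    rw [div_mul_eq_mul_div, div_mul_eq_mul_div, le_div_iff₀ (by positivity)]
    have hA : (0 : ℝ) ≤ 2 * (c + 3) * (n * k) := by positivity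
    nlinarith [mul_le_mul_of_nonneg_left hsq hA]

/-! ### The lower bound -/

/-- A deterministic algorithm with `q` queries identifies at most `q + 1` members of a family of
posets each of which differs from `P₀` on its own set of edges: along the path for `P₀`, each query
distinguishes at most one member from `P₀`. -/
theorem card_correct_le {V ι : Type} [Fintype ι] {G : SimpleGraph V} {Q : ι → PartialOrder V}
    {P₀ : PartialOrder V} (hinj : Function.Injective Q)
    (hdiff : ∀ (u v : V), G.Adj u v → ∀ i j, answer (Q i) u v ≠ answer P₀ u v →
      answer (Q j) u v ≠ answer P₀ u v → i = j)
    (t : QueryTree G) (q : ℕ) (T : Finset ι)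
    (hT : ∀ i ∈ T, t.result (Q i) = Q i ∧ t.cost (Q i) ≤ q) : T.card ≤ q + 1 := by
  classical
  induction t generalizing q T with
  | output R =>
    refine (Finset.card_le_one.2 fun i hi j hj => hinj ?_).trans (by omega)
    exact ((hT i hi).1.symm).trans (hT j hj).1
  | query e next ih =>
    obtain _ | q := q
    · have : T = ∅ := Finset.eq_empty_of_forall_notMem fun i hi => by
        have := (hT i hi).2
        simp [QueryTree.cost] at this
      simp [this]
    · have h1 := ih (answer P₀ e.fst e.snd) q
        (T.filter fun i => answer (Q i) e.fst e.snd = answer P₀ e.fst e.snd) (by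
          intro i hi
          obtain ⟨hiT, hans⟩ := Finset.mem_filter.1 hi
          have := hT i hiT
          simp only [QueryTree.result, QueryTree.cost, hans] at this
          exact ⟨this.1, by omega⟩)
      have h2 : (T.filter fun i => ¬ answer (Q i) e.fst e.snd = answer P₀ e.fst e.snd).card ≤ 1 :=
        Finset.card_le_one.2 fun i hi j hj => hdiff _ _ e.adj i j
          (Finset.mem_filter.1 hi).2 (Finset.mem_filter.1 hj).2
      have h3 := T.card_filter_add_card_filter_not
        fun i => answer (Q i) e.fst e.snd = answer P₀ e.fst e.snd
      omega

theorem card_div_six_le {V ι : Type} [Fintype ι] {G : SimpleGraph V} {Q : ι → PartialOrder V}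
    {P₀ : PartialOrder V} (hinj : Function.Injective Q)
    (hdiff : ∀ (u v : V), G.Adj u v → ∀ i j, answer (Q i) u v ≠ answer P₀ u v →
      answer (Q j) u v ≠ answer P₀ u v → i = j)
    (hι : 2 ≤ Fintype.card ι) (A : RandomizedAlgorithm G) (q : ℝ)
    (hA : ∀ i, 2 / 3 ≤ successProb A (Q i) q) : (Fintype.card ι : ℝ) / 6 ≤ q := by
  classical
  let S : ι → Set (QueryTree G) := fun i => {t | t.result (Q i) = Q i ∧ (t.cost (Q i) : ℝ) ≤ q}
  have hpoint : ∀ t, ∑ i, (S i).indicator A t ≤ A t * ((⌊q⌋₊ + 1 : ℕ) : ENNReal) := by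
    intro t
    have hcard := card_correct_le hinj hdiff t ⌊q⌋₊ (Finset.univ.filter fun i => t ∈ S i) (by
      intro i hi
      have := (Finset.mem_filter.1 hi).2
      exact ⟨this.1, Nat.le_floor this.2⟩)
    calc ∑ i, (S i).indicator A t
        = ∑ i ∈ Finset.univ.filter (fun i => t ∈ S i), A t := by
          rw [Finset.sum_filter]
          exact Finset.sum_congr rfl fun i _ => Set.indicator_apply _ _ _
      _ = ((Finset.univ.filter fun i => t ∈ S i).card : ENNReal) * A t := by
          rw [Finset.sum_const, nsmul_eq_mul]
      _ ≤ ((⌊q⌋₊ + 1 : ℕ) : ENNReal) * A t := by gcongr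
      _ = _ := mul_comm _ _
  have hsum : ∑ i, A.toOuterMeasure (S i) ≤ ((⌊q⌋₊ + 1 : ℕ) : ENNReal) := by
    calc ∑ i, A.toOuterMeasure (S i) = ∑ i, ∑' t, (S i).indicator A t := by
          simp only [PMF.toOuterMeasure_apply]
      _ = ∑' t, ∑ i, (S i).indicator A t :=
          (Summable.tsum_finsetSum fun _ _ => ENNReal.summable).symm
      _ ≤ ∑' t, A t * ((⌊q⌋₊ + 1 : ℕ) : ENNReal) := ENNReal.tsum_le_tsum hpoint
      _ = _ := by rw [ENNReal.tsum_mul_right, A.tsum_coe, one_mul]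
  have htop : ∀ i, A.toOuterMeasure (S i) ≠ ⊤ := fun i =>
    ne_top_of_le_ne_top (ENNReal.natCast_ne_top _)
      ((Finset.single_le_sum (fun _ _ => zero_le) (Finset.mem_univ i)).trans hsum)
  have hreal : ∑ i, successProb A (Q i) q ≤ (⌊q⌋₊ + 1 : ℕ) := by
    have := ENNReal.toReal_mono (ENNReal.natCast_ne_top _) hsum
    rwa [ENNReal.toReal_sum fun i _ => htop i, ENNReal.toReal_natCast] at this
  have hlow : (Fintype.card ι : ℝ) * (2 / 3) ≤ ∑ i, successProb A (Q i) q := by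
    have := Finset.card_nsmul_le_sum Finset.univ (fun i => successProb A (Q i) q) (2 / 3)
      fun i _ => hA i
    rwa [Finset.card_univ, nsmul_eq_mul] at this
  have hcard : (2 : ℝ) ≤ Fintype.card ι := by exact_mod_cast hι
  push_cast at hreal
  rcases lt_or_ge q 0 with hq | hq
  · rw [Nat.floor_of_nonpos hq.le] at hreal
    norm_num at hreal
    linarith
  · have := Nat.floor_le hq
    linarith

theorem answer_congr {V : Type} {P Q : PartialOrder V} {u v : V} (h1 : P.lt u v ↔ Q.lt u v)
    (h2 : P.lt v u ↔ Q.lt v u) : answer P u v = answer Q u v := by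
  unfold answer
  split_ifs <;> first | rfl | (exfalso; tauto)

theorem isInstance_of_two_steps {V : Type} {G : SimpleGraph V} {P : PartialOrder V}
    (h : ∀ u v, P.lt u v → G.Adj u v ∨
      ∃ w, (G.Adj u w ∧ P.lt u w) ∧ G.Adj w v ∧ P.lt w v) : IsInstance G P := by
  intro u v
  constructor
  · intro huv
    rcases h u v huv with hadj | ⟨w, h1, h2⟩
    · exact .single ⟨hadj, huv⟩
    · exact .tail (.single h1) h2
  · intro huv
    induction huv with
    | single h => exact h.2
    | tail _ h ih => exact lt_trans ih h.2

theorem width_orderOfLt {V : Type} [Fintype V] {r : V → V → Prop} {h1 : ∀ x, ¬ r x x}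
    {h2 : ∀ x y z, r x y → r y z → r x z} {k : ℕ} (A : Finset V) (hA : A.card = k)
    (hAr : ∀ x ∈ A, ∀ y ∈ A, ¬ r x y)
    (hk : ∀ S : Finset V, (∀ x ∈ S, ∀ y ∈ S, ¬ r x y) → S.card ≤ k) :
    width (orderOfLt r h1 h2) = k := by
  classical
  apply le_antisymm
  · refine Finset.sup_le fun S hS => hk S fun x hx y hy hxy => ?_
    have hne : x ≠ y := fun h => h1 x (h ▸ hxy)
    exact (Finset.mem_filter.1 hS).2 hx hy hne (Or.inr hxy)
  · rw [← hA]
    refine Finset.le_sup (f := Finset.card) (Finset.mem_filter.2 ⟨Finset.mem_univ _, ?_⟩)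
    rintro x hx y hy hne (h | h)
    · exact hne h
    · exact hAr x hx y hy h

/-- The complete bipartite graph on `Fin n` whose sides are the elements with an even and those with
an odd value of `c`. -/
def parityGraph {n : ℕ} (c : ℕ → ℕ) : SimpleGraph (Fin n) where
  Adj u v := c u % 2 ≠ c v % 2
  symm := ⟨fun _ _ h => Ne.symm h⟩
  loopless := ⟨fun _ h => h rfl⟩

theorem isCompleteBipartite_parityGraph {n : ℕ} (c : ℕ → ℕ) :
    IsCompleteBipartite (parityGraph c : SimpleGraph (Fin n)) := by
  refine ⟨{u | c u % 2 = 0}, fun u v => ?_⟩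
  simp only [parityGraph, Set.mem_ofPred_eq]
  omega

/-- The conclusion of the lower bound for given `n` and `k`, with the constant `1 / 100`. -/
def HasLowerBound (n k : ℕ) : Prop :=
  ∃ G : SimpleGraph (Fin n), IsCompleteBipartite G ∧
    ∀ (A : RandomizedAlgorithm G) (q : ℝ),
      (∀ P : PartialOrder (Fin n), IsInstance G P → width P = k → 2 / 3 ≤ successProb A P q) →
      1 / 100 * ((n : ℝ) * k) ≤ q

/-- To prove the lower bound, it suffices to exhibit a large family of instances given by strict
orders `r i` that differ from a strict order `r₀` on disjoint sets of edges. -/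
theorem hasLowerBound_of_family {n k : ℕ} {ι : Type} [Fintype ι] (c : ℕ → ℕ)
    (r : ι → Fin n → Fin n → Prop) (r₀ : Fin n → Fin n → Prop)
    (irrefl : ∀ i x, ¬ r i x x) (trans : ∀ i x y z, r i x y → r i y z → r i x z)
    (irrefl₀ : ∀ x, ¬ r₀ x x) (trans₀ : ∀ x y z, r₀ x y → r₀ y z → r₀ x z)
    (hsteps : ∀ i (u v : Fin n), r i u v → c u % 2 ≠ c v % 2 ∨
      ∃ w : Fin n, (c u % 2 ≠ c w % 2 ∧ r i u w) ∧ c w % 2 ≠ c v % 2 ∧ r i w v)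
    (hwidth : ∀ i, width (orderOfLt (r i) (irrefl i) (trans i)) = k)
    (hinj : ∀ i j, (∀ u v, r i u v ↔ r j u v) → i = j)
    (hdiff : ∀ u v : Fin n, c u % 2 ≠ c v % 2 → ∀ i j,
      ¬ ((r i u v ↔ r₀ u v) ∧ (r i v u ↔ r₀ v u)) →
      ¬ ((r j u v ↔ r₀ u v) ∧ (r j v u ↔ r₀ v u)) → i = j)
    (hι : 2 ≤ Fintype.card ι) (hcard : 6 * (n * k) ≤ 100 * Fintype.card ι) :
    HasLowerBound n k := by
  refine ⟨parityGraph c, isCompleteBipartite_parityGraph c, fun A q hA => ?_⟩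
  have key := card_div_six_le (G := parityGraph c)
    (Q := fun i => orderOfLt (r i) (irrefl i) (trans i)) (P₀ := orderOfLt r₀ irrefl₀ trans₀)
    (fun i j hij => hinj i j fun u v => by
      have := congrArg (fun P : PartialOrder (Fin n) => P.lt u v) hij
      exact iff_of_eq this)
    (fun u v huv i j hi hj => hdiff u v huv i j
      (fun h => hi (answer_congr h.1 h.2)) (fun h => hj (answer_congr h.1 h.2)))
    hι A q (fun i => hA _ (isInstance_of_two_steps (hsteps i)) (hwidth i))
  have : (6 : ℝ) * (n * k) ≤ 100 * Fintype.card ι := by exact_mod_cast hcard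
  linarith

theorem card_le_of_forall_le_lt {n k a : ℕ} (S : Finset (Fin n))
    (hS : ∀ x ∈ S, a ≤ (x : ℕ) ∧ (x : ℕ) < a + k) : S.card ≤ k := by
  have h : (S.map Fin.valEmbedding) ⊆ Finset.Ico a (a + k) := by
    intro y hy
    obtain ⟨x, hx, rfl⟩ := Finset.mem_map.1 hy
    exact Finset.mem_Ico.2 (hS x hx)
  simpa using Finset.card_le_card h

/-- Layers of size `k`, with exactly one incomparable pair of elements of consecutive layers. -/
theorem hasLowerBound_of_le {n k : ℕ} (hk : 2 ≤ k) (hkn : 4 * k ≤ 3 * n) :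
    HasLowerBound n k := by
  have hk0 : 0 < k := by omega
  -- the incomparable pair consists of `k + i` and the `j`-th element of the preceding layer
  let low : Fin (n - k) × Fin k → ℕ := fun p => p.1 / k * k + p.2
  let high : Fin (n - k) × Fin k → ℕ := fun p => k + p.1
  have hlow : ∀ p, low p / k = p.1 / k := fun p => by
    simp only [low]
    rw [mul_comm, Nat.mul_add_div hk0, Nat.div_eq_of_lt p.2.2, add_zero]
  have hhigh : ∀ p, high p / k = p.1 / k + 1 := fun p => by
    simp only [high]
    rw [Nat.add_div_left _ hk0]
  have hlown : ∀ p, low p < n := fun p => by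
    have h1 := Nat.div_mul_le_self (p.1 : ℕ) k
    have h2 := p.1.2
    have h3 := p.2.2
    simp only [low]
    omega
  have hhighn : ∀ p, high p < n := fun p => by
    have h2 := p.1.2
    simp only [high]
    omega
  have hpair : ∀ p p', low p = low p' → high p = high p' → p = p' := by
    rintro ⟨i, j⟩ ⟨i', j'⟩ h1 h2
    simp only [low, high] at h1 h2
    have hi : i = i' := Fin.ext (by omega)
    subst hi
    exact Prod.ext rfl (Fin.ext (by simpa using h1))
  let r : Fin (n - k) × Fin k → Fin n → Fin n → Prop := fun p x y =>
    (x : ℕ) / k < y / k ∧ ¬ ((x : ℕ) = low p ∧ (y : ℕ) = high p)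
  have hlayer : ∀ p x y, ¬ r p x y → (x : ℕ) / k < y / k → (x : ℕ) = low p ∧ (y : ℕ) = high p := by
    intro p x y h1 h2
    by_contra h
    exact h1 ⟨h2, h⟩
  refine hasLowerBound_of_family (fun x => x / k) r (fun x y => (x : ℕ) / k < y / k)
    (fun p x h => lt_irrefl _ h.1) ?_ (fun x => lt_irrefl _) (fun x y z => lt_trans)
    ?_ ?_ ?_ ?_ ?_ ?_
  · rintro p x y z ⟨h1, -⟩ ⟨h2, -⟩
    refine ⟨h1.trans h2, ?_⟩
    rintro ⟨hx, hz⟩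
    rw [hx, hlow] at h1
    rw [hz, hhigh] at h2
    omega
  · rintro p u v ⟨huv, hne⟩
    by_cases hpar : (u : ℕ) / k % 2 = v / k % 2
    swap
    · exact Or.inl hpar
    refine Or.inr ?_
    -- the layer after that of `u` has two elements; one of them is above `u` and below `v`
    have hv := v.2
    have hvk := Nat.div_mul_le_self (v : ℕ) k
    have hle : ((u : ℕ) / k + 2) * k ≤ v / k * k := Nat.mul_le_mul_right k (by omega)
    have hmem : ∀ e < k, ∃ w : Fin n, (w : ℕ) = ((u : ℕ) / k + 1) * k + e ∧
        (w : ℕ) / k = u / k + 1 := by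
      intro e he
      refine ⟨⟨((u : ℕ) / k + 1) * k + e, ?_⟩, rfl, ?_⟩
      · rw [add_mul] at hle ⊢
        omega
      · simp only
        rw [mul_comm, Nat.mul_add_div hk0, Nat.div_eq_of_lt he, add_zero]
    obtain ⟨w₀, hw₀, hl₀⟩ := hmem 0 (by omega)
    obtain ⟨w₁, hw₁, hl₁⟩ := hmem 1 (by omega)
    have hlp := hlow p
    have hhp := hhigh p
    by_cases hgood : r p u w₀ ∧ r p w₀ v
    · exact ⟨w₀, ⟨by omega, hgood.1⟩, by omega, hgood.2⟩
    · refine ⟨w₁, ⟨by omega, by omega, ?_⟩, by omega, by omega, ?_⟩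
      · rintro ⟨h1, h2⟩
        refine hgood ⟨⟨by omega, by omega⟩, by omega, ?_⟩
        rintro ⟨h3, h4⟩
        rw [h1] at hl₀
        rw [h3] at hl₀
        omega
      · rintro ⟨h1, h2⟩
        refine hgood ⟨⟨by omega, ?_⟩, by omega, by omega⟩
        rintro ⟨h3, h4⟩
        rw [h1] at hl₁
        rw [h3] at hl₁
        omega
  · intro p
    refine width_orderOfLt ((Finset.univ : Finset (Fin k)).map
      (Fin.castLEEmb (by omega : k ≤ n))) (by simp) ?_ ?_
    · intro x hx y hy hxy
      obtain ⟨y', -, rfl⟩ := Finset.mem_map.1 hy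
      have : ((Fin.castLEEmb (by omega : k ≤ n) y' : Fin n) : ℕ) / k = 0 :=
        Nat.div_eq_of_lt y'.2
      exact Nat.not_lt_zero _ (this ▸ hxy.1)
    · intro S hS
      by_cases hsame : ∀ x ∈ S, ∀ y ∈ S, (x : ℕ) / k = y / k
      · rcases S.eq_empty_or_nonempty with rfl | ⟨a, ha⟩
        · simp
        · refine card_le_of_forall_le_lt (a := a / k * k) S fun x hx => ?_
          have h1 := Nat.div_add_mod (x : ℕ) k
          have h2 := Nat.mod_lt (x : ℕ) hk0
          rw [hsame x hx a ha, mul_comm] at h1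
          omega
      · -- an antichain that meets two layers is the incomparable pair
        have hex : ∃ x ∈ S, ∃ y ∈ S, (x : ℕ) / k < y / k := by
          push Not at hsame
          obtain ⟨x, hx, y, hy, hne⟩ := hsame
          rcases Nat.lt_or_gt_of_ne hne with h | h
          · exact ⟨x, hx, y, hy, h⟩
          · exact ⟨y, hy, x, hx, h⟩
        obtain ⟨x, hx, y, hy, hxy⟩ := hex
        have hp := hlayer p x y (hS x hx y hy) hxy
        have hsub : S ⊆ {x, y} := by
          intro z hz
          rw [Finset.mem_insert, Finset.mem_singleton]
          rcases lt_or_ge ((x : ℕ) / k) ((z : ℕ) / k) with h | h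
          · have := hlayer p x z (hS x hx z hz) h
            exact Or.inr (Fin.ext (by omega))
          · have := hlayer p z y (hS z hz y hy) (by omega)
            exact Or.inl (Fin.ext (by omega))
        exact (Finset.card_le_card hsub).trans (Finset.card_le_two.trans hk)
  · intro p p' h
    have h1 := h ⟨low p, hlown p⟩ ⟨high p, hhighn p⟩
    have h2 : ¬ r p ⟨low p, hlown p⟩ ⟨high p, hhighn p⟩ := fun h => h.2 ⟨rfl, rfl⟩
    rw [h1] at h2
    have h3 := hlayer p' _ _ h2 (by
      have h4 := hlow p
      have h5 := hhigh p
      simp only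
      omega)
    exact hpair p p' h3.1 h3.2
  · intro u v huv p p' hp hp'
    have key : ∀ p, ¬ ((r p u v ↔ (u : ℕ) / k < v / k) ∧ (r p v u ↔ (v : ℕ) / k < u / k)) →
        ((u : ℕ) = low p ∧ (v : ℕ) = high p) ∨ ((v : ℕ) = low p ∧ (u : ℕ) = high p) := by
      intro p hp
      by_contra h
      exact hp ⟨⟨fun h' => h'.1, fun h' => ⟨h', fun e => h (Or.inl e)⟩⟩,
        ⟨fun h' => h'.1, fun h' => ⟨h', fun e => h (Or.inr e)⟩⟩⟩
    have a1 := hlow p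
    have a2 := hhigh p
    have a3 := hlow p'
    have a4 := hhigh p'
    rcases key p hp with ⟨h1, h2⟩ | ⟨h1, h2⟩ <;> rcases key p' hp' with ⟨h3, h4⟩ | ⟨h3, h4⟩
    · exact hpair p p' (h1.symm.trans h3) (h2.symm.trans h4)
    · rw [← h1] at a1; rw [← h2] at a2; rw [← h3] at a3; rw [← h4] at a4
      omega
    · rw [← h1] at a1; rw [← h2] at a2; rw [← h3] at a3; rw [← h4] at a4
      omega
    · exact hpair p p' (h1.symm.trans h3) (h2.symm.trans h4)
  · rw [Fintype.card_prod, Fintype.card_fin, Fintype.card_fin]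
    have : 1 * 2 ≤ (n - k) * k := Nat.mul_le_mul (by omega) hk
    omega
  · rw [Fintype.card_prod, Fintype.card_fin, Fintype.card_fin]
    have : n * k ≤ (4 * (n - k)) * k := Nat.mul_le_mul_right k (by omega)
    nlinarith

/-- A chain of `n - k` elements and an antichain to which one comparable pair is added. -/
theorem hasLowerBound_of_gt {n k : ℕ} (hk : k < n) (hkn : 3 * n < 4 * k) :
    HasLowerBound n k := by
  obtain ⟨m, rfl⟩ : ∃ m, n = m + k + 1 := ⟨n - k - 1, by omega⟩
  let low : Fin (k / 2) × Fin (k / 2) → ℕ := fun p => m + 1 + 2 * p.1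
  let high : Fin (k / 2) × Fin (k / 2) → ℕ := fun p => m + 2 + 2 * p.2
  have hlow : ∀ p, m < low p ∧ low p < m + k + 1 ∧ low p % 2 = (m + 1) % 2 := fun p => by
    have := p.1.2
    simp only [low]
    omega
  have hhigh : ∀ p, m < high p ∧ high p < m + k + 1 ∧ high p % 2 = m % 2 := fun p => by
    have := p.2.2
    simp only [high]
    omega
  have hpair : ∀ p p', low p = low p' → high p = high p' → p = p' := by
    intro p p' h1 h2
    simp only [low, high] at h1 h2
    exact Prod.ext (Fin.ext (by omega)) (Fin.ext (by omega))
  let r : Fin (k / 2) × Fin (k / 2) → Fin (m + k + 1) → Fin (m + k + 1) → Prop := fun p x y =>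
    ((x : ℕ) < y ∧ (y : ℕ) ≤ m) ∨ ((x : ℕ) = low p ∧ (y : ℕ) = high p)
  have h2 : 3 * k ≤ 8 * (k / 2) := by omega
  refine hasLowerBound_of_family (fun x => x) r (fun x y => (x : ℕ) < y ∧ (y : ℕ) ≤ m)
    ?_ ?_ (fun x h => lt_irrefl _ h.1) (fun x y z h h' => ⟨h.1.trans h'.1, h'.2⟩)
    ?_ ?_ ?_ ?_ ?_ ?_
  · intro p x h
    have := hlow p
    have := hhigh p
    simp only [r] at h
    omega
  · intro p x y z h h'
    have := hlow p
    have := hhigh p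
    simp only [r] at h h' ⊢
    omega
  · intro p u v h
    have := hlow p
    have := hhigh p
    simp only [r] at h ⊢
    by_cases hpar : (u : ℕ) % 2 = v % 2
    · refine Or.inr ⟨⟨u + 1, by omega⟩, ?_⟩
      simp only
      omega
    · exact Or.inl hpar
  · intro p
    have hl := hlow p
    have hh := hhigh p
    refine width_orderOfLt (((Finset.univ : Finset (Fin (m + k + 1))).filter
      fun x : Fin (m + k + 1) => m ≤ (x : ℕ)).erase ⟨low p, hl.2.1⟩) ?_ ?_ ?_
    · rw [Finset.card_erase_of_mem (by simpa using hl.1.le)]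
      have : ((Finset.univ : Finset (Fin (m + k + 1))).filter fun x : Fin (m + k + 1) => m ≤ (x : ℕ)) =
          Finset.Ici ⟨m, by omega⟩ := by
        ext x
        simp [Fin.le_def]
      rw [this, Fin.card_Ici]
      simp only
      omega
    · intro x hx y hy hxy
      have hx1 := Finset.mem_erase.1 hx
      have hx2 := (Finset.mem_filter.1 hx1.2).2
      have hx3 : (x : ℕ) ≠ low p := fun h => hx1.1 (Fin.ext h)
      have hy2 := (Finset.mem_filter.1 (Finset.mem_erase.1 hy).2).2
      simp only [r] at hxy
      omega
    · intro S hS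
      -- at most one element of `S` is in the chain, and at most one in the comparable pair
      have h1 : (S.filter fun x : Fin (m + k + 1) => (x : ℕ) ≤ m).card ≤ 1 := by
        refine Finset.card_le_one.2 fun x hx y hy => ?_
        obtain ⟨hxS, hxm⟩ := Finset.mem_filter.1 hx
        obtain ⟨hyS, hym⟩ := Finset.mem_filter.1 hy
        have a := hS x hxS y hyS
        have b := hS y hyS x hxS
        simp only [r] at a b
        exact Fin.ext (by omega)
      have h2 : (S.filter fun x : Fin (m + k + 1) => ¬ (x : ℕ) ≤ m).card ≤ k - 1 := by
        obtain ⟨z, hzm, hz⟩ : ∃ z : Fin (m + k + 1), m < (z : ℕ) ∧ z ∉ S := by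
          by_cases hlS : ⟨low p, hl.2.1⟩ ∈ S
          · exact ⟨⟨high p, hh.2.1⟩, hh.1, fun h => hS _ hlS _ h (Or.inr ⟨rfl, rfl⟩)⟩
          · exact ⟨⟨low p, hl.2.1⟩, hl.1, hlS⟩
        have hsub : (S.filter fun x : Fin (m + k + 1) => ¬ (x : ℕ) ≤ m) ⊆
            (Finset.Ioi (⟨m, by omega⟩ : Fin (m + k + 1))).erase z := by
          intro x hx
          obtain ⟨hxS, hxm⟩ := Finset.mem_filter.1 hx
          refine Finset.mem_erase.2 ⟨fun h => hz (h ▸ hxS), Finset.mem_Ioi.2 ?_⟩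
          exact Fin.lt_def.2 (not_le.1 hxm)
        refine (Finset.card_le_card hsub).trans ?_
        rw [Finset.card_erase_of_mem (Finset.mem_Ioi.2 (Fin.lt_def.2 hzm)), Fin.card_Ioi]
        simp only
        omega
      have h3 := S.card_filter_add_card_filter_not fun x : Fin (m + k + 1) => (x : ℕ) ≤ m
      omega
  · intro p p' h
    have a1 := hlow p
    have a2 := hhigh p
    have h1 := (h ⟨low p, a1.2.1⟩ ⟨high p, a2.2.1⟩).1 (Or.inr ⟨rfl, rfl⟩)
    simp only [r] at h1
    exact hpair p p' (by omega) (by omega)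
  · intro u v huv p p' hp hp'
    have a1 := hlow p
    have a2 := hhigh p
    have a3 := hlow p'
    have a4 := hhigh p'
    simp only [r] at hp hp'
    exact hpair p p' (by omega) (by omega)
  · rw [Fintype.card_prod, Fintype.card_fin]
    have : 2 * 2 ≤ k / 2 * (k / 2) := Nat.mul_le_mul (by omega) (by omega)
    omega
  · rw [Fintype.card_prod, Fintype.card_fin]
    have h3 : (3 * k) * (3 * k) ≤ (8 * (k / 2)) * (8 * (k / 2)) := Nat.mul_le_mul h2 h2
    have h4 : 3 * (m + k + 1) * k ≤ 4 * k * k := Nat.mul_le_mul_right k hkn.le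
    nlinarith

/-- A chain and the opposite chain. -/
theorem hasLowerBound_one_of_le {n : ℕ} (hn : 2 ≤ n) (hn' : n ≤ 4) : HasLowerBound n 1 := by
  refine hasLowerBound_of_family (ι := Bool) (fun x => x)
    (fun b x y => if b then (x : ℕ) < y else (y : ℕ) < x) (fun x y => (x : ℕ) < y)
    ?_ ?_ (fun x => lt_irrefl _) (fun x y z => lt_trans) ?_ ?_ ?_ ?_ (by simp) (by simp; omega)
  · rintro (_ | _) x <;> simp
  · rintro (_ | _) x y z <;> simp <;> omega
  · rintro b u v h
    by_cases hpar : (u : ℕ) % 2 = v % 2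
    swap
    · exact Or.inl hpar
    rcases b with _ | _
    · simp only [Bool.false_eq_true, if_false] at h ⊢
      refine Or.inr ⟨⟨u - 1, by omega⟩, ?_⟩
      simp only
      omega
    · simp only [if_true] at h ⊢
      refine Or.inr ⟨⟨u + 1, by omega⟩, ?_⟩
      simp only
      omega
  · intro b
    refine width_orderOfLt {(⟨0, by omega⟩ : Fin n)} (by simp) (by cases b <;> simp) fun S hS => ?_
    refine Finset.card_le_one.2 fun x hx y hy => Fin.ext ?_
    have h1 := hS x hx y hy
    have h2 := hS y hy x hx
    cases b <;> simp at h1 h2 <;> omega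
  · intro b b' h
    have := h ⟨0, by omega⟩ ⟨1, by omega⟩
    cases b <;> cases b' <;> simp at this ⊢
  · intro u v _ b b' hb hb'
    cases b <;> cases b' <;> simp at hb hb' ⊢

/-- Chains that differ by the exchange of two elements at distance `2`. -/
theorem hasLowerBound_one_of_ge {n : ℕ} (hn : 5 ≤ n) : HasLowerBound n 1 := by
  let key : ℕ → ℕ → ℕ := fun j x =>
    if x = 2 * j then 2 * j + 2 else if x = 2 * j + 2 then 2 * j else x
  have hkey : ∀ j x, (x = 2 * j ∧ key j x = 2 * j + 2) ∨ (x = 2 * j + 2 ∧ key j x = 2 * j) ∨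
      (x ≠ 2 * j ∧ x ≠ 2 * j + 2 ∧ key j x = x) := by
    intro j x
    simp only [key]
    split_ifs <;> omega
  refine hasLowerBound_of_family (ι := Fin ((n - 1) / 2)) (fun x => x)
    (fun j x y => key j x < key j y) (fun x y => (x : ℕ) < y)
    (fun j x => lt_irrefl _) (fun j x y z => lt_trans) (fun x => lt_irrefl _)
    (fun x y z => lt_trans) ?_ ?_ ?_ ?_ ?_ ?_
  · intro j u v h
    by_cases hpar : (u : ℕ) % 2 = v % 2
    swap
    · exact Or.inl hpar
    have hj := j.2
    have h1 := hkey j u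
    have h2 := hkey j v
    -- `key j` is an involution, so `w` is the successor of `u`
    have h3 := hkey j (key j u + 1)
    have h4 := hkey j (key j (key j u + 1))
    refine Or.inr ⟨⟨key j (key j u + 1), by omega⟩, ?_⟩
    simp only
    omega
  · intro j
    refine width_orderOfLt {(⟨0, by omega⟩ : Fin n)} (by simp) (by simp) fun S hS => ?_
    refine Finset.card_le_one.2 fun x hx y hy => Fin.ext ?_
    have h1 := hS x hx y hy
    have h2 := hS y hy x hx
    have h3 := hkey j x
    have h4 := hkey j y
    omega
  · intro i j h
    have hi := i.2
    have h1 := h ⟨2 * i, by omega⟩ ⟨2 * i + 1, by omega⟩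
    have h2 := h ⟨2 * i + 1, by omega⟩ ⟨2 * i + 2, by omega⟩
    have a1 := hkey i (2 * i)
    have a2 := hkey i (2 * i + 1)
    have a3 := hkey i (2 * i + 2)
    have b1 := hkey j (2 * i)
    have b2 := hkey j (2 * i + 1)
    have b3 := hkey j (2 * i + 2)
    simp only at h1 h2
    exact Fin.ext (by omega)
  · intro u v huv i j hi hj
    have a1 := hkey i u
    have a2 := hkey i v
    have b1 := hkey j u
    have b2 := hkey j v
    -- the edges that show the `i`-th exchange are `{2 i, 2 i + 1}` and `{2 i + 1, 2 i + 2}`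
    have hi' : min (u : ℕ) v / 2 = i := by omega
    have hj' : min (u : ℕ) v / 2 = j := by omega
    exact Fin.ext (hi'.symm.trans hj')
  · rw [Fintype.card_fin]
    omega
  · rw [Fintype.card_fin]
    omega

theorem hasLowerBound {n k : ℕ} (hk : 1 ≤ k) (hkn : k < n) : HasLowerBound n k := by
  rcases Nat.eq_or_lt_of_le hk with rfl | hk
  · rcases Nat.lt_or_ge n 5 with h | h
    · exact hasLowerBound_one_of_le hkn (by omega)
    · exact hasLowerBound_one_of_ge h
  · rcases Nat.lt_or_ge (3 * n) (4 * k) with h | h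
    · exact hasLowerBound_of_gt hkn h
    · exact hasLowerBound_of_le hk h

end GPS

theorem theorem2 :
    -- upper bound: one algorithm, which knows the query graph but neither `P` nor `k`
    (∃ (A : ∀ (n : ℕ) (G : SimpleGraph (Fin n)), GPS.RandomizedAlgorithm G) (d : ℕ),
      ∀ c : ℕ, ∃ C : ℝ, 0 < C ∧
        ∀ (n k : ℕ) (G : SimpleGraph (Fin n)) (P : PartialOrder (Fin n)),
          2 ≤ n → GPS.IsCompleteBipartite G → GPS.IsInstance G P → GPS.width P = k →
            1 - 1 / (n : ℝ) ^ c ≤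
              GPS.successProb (A n G) P
                (C * ((n : ℝ) * k) * Real.log ((n : ℝ) * k) ^ d)) ∧
    -- lower bound: tightness up to polylogarithmic factors
    (∃ c : ℝ, 0 < c ∧
      ∀ n k : ℕ, 1 ≤ k → k < n →
        ∃ G : SimpleGraph (Fin n), GPS.IsCompleteBipartite G ∧
          ∀ (A : GPS.RandomizedAlgorithm G) (q : ℝ),
            (∀ P : PartialOrder (Fin n), GPS.IsInstance G P → GPS.width P = k →
              2 / 3 ≤ GPS.successProb A P q) →
            c * ((n : ℝ) * k) ≤ q) := by
  refine ⟨⟨GPS.randomInsertion, 2, GPS.upper_bound⟩, 1 / 100, by norm_num, ?_⟩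
  exact fun n k hk hkn => GPS.hasLowerBound hk hkn
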